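/- **Channel.** Let $0\le\alpha\le1$. The binary erasure channel with erasure probability $\alpha$ has inputs $\{0,1\}$ and outputs $\{0,1,\mathrm e\}$; it outputs $\mathrm e$ with probability $\alpha$ and its input with probability $1-\alpha$, independently over channel uses. The transmitter has a battery of capacity $1$ and one unit of energy arrives at each odd time: $E_t=1$ for $t$ odd, $E_t=0$ for $t$ even, $B_t=\min\{B_{t-1}-X_{t-1}+E_t,1\}$, $B_1=1$ (so $B_t=1$ for $t$ odd and $B_t=1-X_{t-1}$ for $t$ even), and the inputs must satisfy $X_t\le B_t$. An $(M,n)$ code without feedback consists of an encoder $f:\{1,\dots,M\}\to\{0,1\}^n$, each of whose codewords satisfies the energy constraint, and a decoder $g:\{0,1,\mathrm e\}^n\to\{1,\dots,M\}$. A rate $R\ge0$ is achievable if there are $(\lceil 2^{nR}\rceil,n)$ codes whose average error probability (for a uniformly distributed message) tends to $0$ as $n\to\infty$, and the capacity $C(\alpha)$ is the supremum of the achievable rates. Entropies and mutual information are in bits, and $h_2(p)=-p\log_2p-(1-p)\log_2(1-p)$ with $0\log_20=0$. Let $X^2=(X_1,X_2)$ take values in $\{0,1\}^2$ and let $Y^2=(Y_1,Y_2)$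 be the outputs of two independent uses of the erasure channel with inputs $X_1,X_2$. **Statement.** 1. For every $0\le\alpha\le1$, the set of achievable rates has a least upper bound $C(\alpha)$, and $$C(\alpha)=\tfrac12\max I(X^2;Y^2)=\tfrac12\max\,[H(Y^2)-H(Y^2|X^2)]=\tfrac12\max H(Y^2)-h_2(\alpha),$$ where the maxima are over all distributions of $X^2$ with $P(X^2=(1,1))=0$ and are attained. For $0\le\pi\le\frac12$, the distribution $P_\pi$ given by $P_\pi(0,1)=P_\pi(1,0)=\pi$, $P_\pi(0,0)=1-2\pi$, $P_\pi(1,1)=0$ yields $$I(X^2;Y^2)=(1-\alpha)^2[h_2(2\pi)+2\pi]+2\alpha(1-\alpha)h_2(\pi).$$ 2. For every $0\le\alpha<1$ there is exactly one $\pi\in(0,\frac12)$ such that $x=\frac{\pi}{1-\pi}$ satisfies $x^{1/(1-\alpha)}+x-1=0$. For this $\pi$, $P_\pi$ is the unique maximizer of $I(X^2;Y^2)$ over all distributions of $X^2$ with $P(X^2=(1,1))=0$, and $$C(\alpha)=\frac{(1-\alpha)^2[h_2(2\pi)+2\pi]}{2}+\alpha(1-\alpha)h_2(\pi).$$ 3.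 For $\alpha=\frac12$ the solution of the equation in (2) is $\pi=\frac{3-\sqrt5}{2}$, with $|\pi-0.382|<0.0005$, and $$C(\tfrac12)=\tfrac18\Big[h_2(3-\sqrt5)+2h_2\Big(\tfrac{3-\sqrt5}{2}\Big)+3-\sqrt5\Big],\qquad |C(\tfrac12)-0.4339|<0.00005.$$ -/

import Mathlib

open scoped Topology

noncomputable section

namespace EHBEC

/-! ### The energy-harvesting binary erasure channel -/

/-- Energy arrivals at the times `t = 1, 2, 3, …`: one unit at odd times, none at even times. -/
def arrival (t : ℕ) : ℤ := if Odd t then 1 else 0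

/-- The symbol of `x = (x₁, …, xₙ)` sent at time `t`, as an energy; it is `0` outside `1 ≤ t ≤ n`. -/
def symbolAt {n : ℕ} (x : Fin n → Fin 2) (t : ℕ) : ℤ :=
  if h : 1 ≤ t ∧ t ≤ n then (((x ⟨t - 1, by omega⟩ : Fin 2) : ℕ) : ℤ) else 0

/-- The battery level `B_t = min (B_{t-1} - X_{t-1} + E_t) 1` of a unit battery
when `x` is transmitted; time `0` only initialises the recursion and `B_1 = 1`. -/
def battery {n : ℕ} (x : Fin n → Fin 2) : ℕ → ℤ
  | 0 => 0
  | t + 1 => min (battery x t - symbolAt x t + arrival (t + 1)) 1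

/-- The energy constraint `X_t ≤ B_t` for `t = 1, …, n`. -/
def EnergyFeasible {n : ℕ} (x : Fin n → Fin 2) : Prop :=
  ∀ t : ℕ, 1 ≤ t → t ≤ n → symbolAt x t ≤ battery x t

/-- Transition probabilities of the binary erasure channel with erasure probability `α`;
the erasure symbol is `none`. -/
def bec (α : ℝ) (x : Fin 2) : Option (Fin 2) → ℝ
  | none => α
  | some y => if y = x then 1 - α else 0

/-- Transition probabilities of `n` memoryless uses of the binary erasure channel. -/
def becN (α : ℝ) {n : ℕ} (x : Fin n → Fin 2) (y : Fin n → Option (Fin 2)) : ℝ :=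
  ∏ i, bec α (x i) (y i)

/-! ### Codes without feedback, achievable rates, capacity -/

/-- An `(M, n)` code without feedback that obeys the energy constraint. -/
structure Code (M n : ℕ) where
  enc : Fin M → (Fin n → Fin 2)
  dec : (Fin n → Option (Fin 2)) → Fin M
  feasible : ∀ w, EnergyFeasible (enc w)

/-- Probability that the decoded message differs from a uniformly distributed message. -/
def errorProb (α : ℝ) {M n : ℕ} (c : Code M n) : ℝ :=
  (∑ w : Fin M, ∑ y : Fin n → Option (Fin 2),
    if c.dec y ≠ w then becN α (c.enc w) y else 0) / (M : ℝ)

/-- The rate `R` (in bits per channel use) is achievable: there are `(⌈2^(nR)⌉, n)` codes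
whose error probability tends to `0`. -/
def Achievable (α R : ℝ) : Prop :=
  0 ≤ R ∧ ∃ c : (n : ℕ) → Code ⌈(2 : ℝ) ^ ((n : ℝ) * R)⌉₊ n,
    Filter.Tendsto (fun n => errorProb α (c n)) Filter.atTop (𝓝 0)

/-- The capacity without feedback: the supremum of all achievable rates. -/
def capacity (α : ℝ) : ℝ := sSup {R : ℝ | Achievable α R}

/-! ### Information measures in bits, on finite alphabets -/

/-- The binary entropy function. -/
def h₂ (p : ℝ) : ℝ := -p * Real.logb 2 p - (1 - p) * Real.logb 2 (1 - p)

/-- Shannon entropy of a probability mass function. -/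
def entropy {A : Type*} [Fintype A] (p : A → ℝ) : ℝ := -∑ a, p a * Real.logb 2 (p a)

/-- Conditional entropy `H(B | A)` of a joint probability mass function on `A × B`. -/
def condEntropy {A B : Type*} [Fintype A] [Fintype B] (r : A → B → ℝ) : ℝ :=
  -∑ a, ∑ b, r a b * Real.logb 2 (r a b / ∑ b', r a b')

/-- Mutual information `I(A; B)` of a joint probability mass function on `A × B`. -/
def mutualInfo {A B : Type*} [Fintype A] [Fintype B] (r : A → B → ℝ) : ℝ :=
  ∑ a, ∑ b, r a b * Real.logb 2 (r a b / ((∑ b', r a b') * ∑ a', r a' b))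

/-! ### Blocks of two channel uses -/

/-- Distributions of `X² = (X₁, X₂)` on `{0,1}²` with `X² ≠ (1,1)` almost surely. -/
def blockInputs : Set ((Fin 2 → Fin 2) → ℝ) :=
  {P | P ∈ stdSimplex ℝ (Fin 2 → Fin 2) ∧ P ![1, 1] = 0}

/-- Joint distribution of `(X², Y²)`. -/
def blockJoint (α : ℝ) (P : (Fin 2 → Fin 2) → ℝ) (x : Fin 2 → Fin 2)
    (y : Fin 2 → Option (Fin 2)) : ℝ :=
  P x * becN α x y

/-- `I(X²; Y²)`. -/
def blockInfo (α : ℝ) (P : (Fin 2 → Fin 2) → ℝ) : ℝ := mutualInfo (blockJoint α P)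

/-- `H(Y²)`. -/
def blockOutEntropy (α : ℝ) (P : (Fin 2 → Fin 2) → ℝ) : ℝ :=
  entropy (fun y => ∑ x, blockJoint α P x y)

/-- `H(Y² | X²)`. -/
def blockCondEntropy (α : ℝ) (P : (Fin 2 → Fin 2) → ℝ) : ℝ := condEntropy (blockJoint α P)

/-- The input distribution with `P(0,1) = P(1,0) = π`, `P(0,0) = 1 - 2π`, `P(1,1) = 0`. -/
def symInput (π : ℝ) (x : Fin 2 → Fin 2) : ℝ :=
  if x = ![0, 0] then 1 - 2 * π else if x = ![1, 1] then 0 else π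

/-- `P` maximises `I(X²; Y²)` over all input distributions with `X² ≠ (1,1)`. -/
def IsOptimalInput (α : ℝ) (P : (Fin 2 → Fin 2) → ℝ) : Prop :=
  P ∈ blockInputs ∧ IsMaxOn (blockInfo α) blockInputs P

/-- The stationarity equation `x^(1/(1-α)) + x - 1 = 0` with `x = π/(1-π)`. -/
def Stationary (α π : ℝ) : Prop :=
  (π / (1 - π)) ^ (1 / (1 - α)) + π / (1 - π) - 1 = 0

end EHBEC

end

noncomputable section

namespace EHBEC

/-! ### A Chernoff bound on finite product spaces -/

/-! The battery is full at every odd time, so the energy constraint only says that no block (X_1,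
X_2), (X_3, X_4), … equals (1,1) (`energyFeasible_iff_blocks`). The system is therefore a memoryless
channel whose letters are the three allowed pairs, and a block counts as two channel uses, hence the
factor 1/2.

The optimal input is identified before any coding takes place. Given the erasure pattern, what is
seen is X², one coordinate of it, or nothing, so I(X²;Y²) is a nonnegative combination of values of
the concave function `negMulLog` (`blockInfo_eq`). Its tangents at `symInput π` sum to a constant
exactly when `Balanced α π` holds; this proves optimality, and strictness of the tangent bound gives
uniqueness. Taking logarithms turns `Balanced` into the stationarity equation, and monotonicity of
x^r + x gives its unique root.

The same condition says that all three allowed letters have the same divergence `blockDiv α π` from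
the optimal output law (`sum_becN_mul_log`). Feinstein's construction, applied to independent blocks
of law `symInput π`, reaches every rate below that value. The change-of-measure converse, with the
product of this output law as reference, makes the probability of correct decoding vanish above it.
Both directions use one exponential Chernoff estimate, so the coding theorem needs neither typical
sets nor Fano's inequality. -/

theorem eventually_sum_exp_lt_one {ι : Type*} [Fintype ι] (p c : ι → ℝ) (hp : ∑ i, p i = 1)
    (hc : ∑ i, p i * c i < 0) :
    ∀ᶠ s in 𝓝[>] (0 : ℝ), ∑ i, p i * Real.exp (s * c i) < 1 := by
  have hd : HasDerivAt (fun s : ℝ => ∑ i, p i * Real.exp (s * c i)) (∑ i, p i * c i) 0 := by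
    have h : ∀ i ∈ Finset.univ, HasDerivAt (fun s : ℝ => p i * Real.exp (s * c i))
        (p i * c i) 0 := by
      intro i _
      have := (((hasDerivAt_id (0 : ℝ)).mul_const (c i)).exp).const_mul (p i)
      simpa using this
    exact HasDerivAt.fun_sum h
  have hs := (hasDerivAt_iff_tendsto_slope.1 hd).eventually_lt_const hc
  have hle : 𝓝[>] (0 : ℝ) ≤ 𝓝[≠] 0 := nhdsWithin_mono _ fun x hx => ne_of_gt hx
  filter_upwards [hle hs, self_mem_nhdsWithin] with s hs hpos
  have hpos : 0 < s := hpos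
  rw [slope_def_field, div_lt_iff₀ (by simpa using hpos)] at hs
  simp [hp] at hs
  linarith

/-- Markov's inequality for exp(s ∑ c): a small s > 0 brings each moment below 1, since its
derivative at 0 is the negative mean. Finiteness of `A` allows one s for all letters, and ρ is the
worst moment, so the bound is uniform over letter sequences. -/
theorem exists_chernoff_bound {A Ω : Type*} [Finite A] [Nonempty A] [Fintype Ω]
    (p c : A → Ω → ℝ) (hp0 : ∀ a ω, 0 ≤ p a ω) (hp1 : ∀ a, ∑ ω, p a ω = 1)
    (hc : ∀ a, ∑ ω, p a ω * c a ω < 0) :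
    ∃ ρ : ℝ, 0 ≤ ρ ∧ ρ < 1 ∧ ∀ (m : ℕ) (a : Fin m → A),
      ∑ ω : Fin m → Ω, (if 0 ≤ ∑ j, c (a j) (ω j) then ∏ j, p (a j) (ω j) else 0) ≤ ρ ^ m := by
  have h : ∀ᶠ s in 𝓝[>] (0 : ℝ), ∀ a, ∑ ω, p a ω * Real.exp (s * c a ω) < 1 :=
    Filter.eventually_all.2 fun a => eventually_sum_exp_lt_one (p a) (c a) (hp1 a) (hc a)
  obtain ⟨s, hs, hs0⟩ := (h.and self_mem_nhdsWithin).exists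
  have hs0 : 0 < s := hs0
  obtain ⟨b, hb⟩ := Finite.exists_max fun a => ∑ ω, p a ω * Real.exp (s * c a ω)
  have hnn : ∀ a ω, 0 ≤ p a ω * Real.exp (s * c a ω) := fun a ω =>
    mul_nonneg (hp0 a ω) (Real.exp_pos _).le
  refine ⟨_, Finset.sum_nonneg fun ω _ => hnn b ω, hs b, fun m a => ?_⟩
  calc ∑ ω : Fin m → Ω, (if 0 ≤ ∑ j, c (a j) (ω j) then ∏ j, p (a j) (ω j) else 0)
      ≤ ∑ ω : Fin m → Ω, ∏ j, p (a j) (ω j) * Real.exp (s * c (a j) (ω j)) := by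
        refine Finset.sum_le_sum fun ω _ => ?_
        have hP : 0 ≤ ∏ j, p (a j) (ω j) := Finset.prod_nonneg fun j _ => hp0 _ _
        rw [Finset.prod_mul_distrib, ← Real.exp_sum, ← Finset.mul_sum]
        split_ifs with h0
        · exact le_mul_of_one_le_right hP (Real.one_le_exp (mul_nonneg hs0.le h0))
        · exact mul_nonneg hP (Real.exp_pos _).le
    _ = ∏ j, ∑ ω, p (a j) ω * Real.exp (s * c (a j) ω) := by
        rw [Finset.prod_univ_sum, Fintype.piFinset_univ]
    _ ≤ ∏ _j : Fin m, ∑ ω, p b ω * Real.exp (s * c b ω) :=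
        Finset.prod_le_prod (fun j _ => Finset.sum_nonneg fun ω _ => hnn _ ω) fun j _ => hb _
    _ = _ := by simp

/-! ### One-shot bounds for finite channels -/

/-- Feinstein's maximal code construction. -/
theorem exists_code_of_threshold {X Y : Type*} [Fintype X] [Fintype Y] (P : X → ℝ)
    (W : X → Y → ℝ) (hP0 : ∀ x, 0 ≤ P x) (hP1 : ∑ x, P x = 1) (hW0 : ∀ x y, 0 ≤ W x y)
    (hW1 : ∀ x, ∑ y, W x y = 1) {t : ℝ} (ht : 0 < t) (M : ℕ) [NeZero M] :
    ∃ (enc : Fin M → X) (dec : Y → Fin M), ∀ w, 0 < P (enc w) ∧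
      ∑ y, (if dec y ≠ w then W (enc w) y else 0) ≤
        (∑ x, ∑ y, if W x y ≤ t * ∑ x', P x' * W x' y then P x * W x y else 0) + M / t := by
  classical
  set q : Y → ℝ := fun y => ∑ x', P x' * W x' y with hq
  set a : ℝ := ∑ x, ∑ y, if W x y ≤ t * q y then P x * W x y else 0 with ha
  have hPpos : ∃ x, 0 < P x := by
    by_contra! h
    have : ∑ x, P x ≤ 0 := Finset.sum_nonpos fun x _ => h x
    linarith
  -- Greedy induction on the number of codewords; a value `dec y ≥ k` marks an output not yet
  -- assigned to any of them.
  have key : ∀ k ≤ M, ∃ (enc : ℕ → X) (dec : Y → ℕ), ∀ i < k, 0 < P (enc i) ∧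
      (∀ y, dec y = i → t * q y < W (enc i) y) ∧
      1 - (a + M / t) ≤ ∑ y, (if dec y = i then W (enc i) y else 0) := by
    intro k
    induction k with
    | zero =>
      obtain ⟨x, -⟩ := hPpos
      exact fun _ => ⟨fun _ => x, fun _ => 0, fun i hi => absurd hi (Nat.not_lt_zero i)⟩
    | succ k ih =>
      intro hk
      obtain ⟨enc, dec, h⟩ := ih (by omega)
      -- On each region t·q < W(enc i), which integrates to at most 1, so the region has q-mass at
      -- most 1/t.
      have hD : ∑ y, (if dec y < k then q y else 0) ≤ M / t := by
        have h1 : ∀ y, (if dec y < k then q y else 0) =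
            ∑ i ∈ Finset.range k, if dec y = i then q y else 0 := by
          intro y
          rw [Finset.sum_ite_eq]
          simp
        rw [Finset.sum_congr rfl fun y _ => h1 y, Finset.sum_comm]
        have h2 : ∀ i ∈ Finset.range k, ∑ y, (if dec y = i then q y else 0) ≤ 1 / t := by
          intro i hi
          rw [le_div_iff₀ ht, Finset.sum_mul, ← hW1 (enc i)]
          refine Finset.sum_le_sum fun y _ => ?_
          split_ifs with hy
          · have := (h i (Finset.mem_range.1 hi)).2.1 y hy
            linarith
          · simpa using hW0 _ _
        refine (Finset.sum_le_sum h2).trans ?_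
        have hkM : (k : ℝ) ≤ M := by exact_mod_cast (by omega : k ≤ M)
        rw [Finset.sum_const, Finset.card_range, nsmul_eq_mul, mul_one_div]
        gcongr
      set g : X → ℝ := fun x => ∑ y, if ¬ dec y < k ∧ t * q y < W x y then W x y else 0 with hg
      have hsum : 1 - (a + M / t) ≤ ∑ x, P x * g x := by
        have h1 : (1 : ℝ) = ∑ x, ∑ y, P x * W x y := by
          simp_rw [← Finset.mul_sum, hW1, mul_one, hP1]
        have h2 : ∑ x, ∑ y, P x * W x y ≤ ∑ x, ∑ y,
            (P x * (if ¬ dec y < k ∧ t * q y < W x y then W x y else 0) +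
              (if W x y ≤ t * q y then P x * W x y else 0) +
              (if dec y < k then P x * W x y else 0)) := by
          refine Finset.sum_le_sum fun x _ => Finset.sum_le_sum fun y _ => ?_
          have := mul_nonneg (hP0 x) (hW0 x y)
          rw [mul_ite, mul_zero]
          by_cases hy : dec y < k
          · rw [if_neg fun h => h.1 hy, if_pos hy]
            split_ifs <;> linarith
          · by_cases hw : W x y ≤ t * q y
            · rw [if_neg fun h => h.2.not_ge hw, if_pos hw, if_neg hy]
              linarith
            · rw [if_pos ⟨hy, not_le.1 hw⟩, if_neg hw, if_neg hy]
              linarith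
        have h3 : ∑ x, ∑ y, (if dec y < k then P x * W x y else 0) =
            ∑ y, (if dec y < k then q y else 0) := by
          rw [Finset.sum_comm]
          refine Finset.sum_congr rfl fun y _ => ?_
          split_ifs <;> simp [hq]
        simp_rw [Finset.sum_add_distrib, ← Finset.mul_sum] at h2
        rw [h3] at h2
        simp_rw [← Finset.mul_sum] at h1
        linarith
      obtain ⟨x, hx, hgx⟩ : ∃ x, 0 < P x ∧ 1 - (a + M / t) ≤ g x := by
        by_contra! hcon
        obtain ⟨x₀, hx₀⟩ := hPpos
        have hlt : ∑ x, P x * g x < ∑ x, P x * (1 - (a + M / t)) := by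
          refine Finset.sum_lt_sum (fun x _ => ?_) ⟨x₀, Finset.mem_univ _, ?_⟩
          · rcases (hP0 x).eq_or_lt with h0 | h0
            · simp [← h0]
            · exact mul_le_mul_of_nonneg_left (hcon x h0).le h0.le
          · exact mul_lt_mul_of_pos_left (hcon x₀ hx₀) hx₀
        rw [← Finset.sum_mul, hP1, one_mul] at hlt
        linarith
      -- The new codeword receives the unassigned outputs above its threshold; the value k + 1 keeps
      -- the others unassigned.
      refine ⟨Function.update enc k x,
        fun y => if dec y < k then dec y else if t * q y < W x y then k else k + 1,
        fun i hi => ?_⟩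
      rcases Nat.lt_succ_iff_lt_or_eq.1 hi with hi | rfl
      · rw [Function.update_of_ne hi.ne]
        obtain ⟨h1, h2, h3⟩ := h i hi
        have hiff : ∀ y, (if dec y < k then dec y else if t * q y < W x y then k else k + 1) = i ↔
            dec y = i := by
          intro y
          split_ifs <;> omega
        simp only [hiff]
        exact ⟨h1, h2, h3⟩
      · have hiff : ∀ y, (if dec y < i then dec y else if t * q y < W x y then i else i + 1) = i ↔
            ¬ dec y < i ∧ t * q y < W x y := by
          intro y
          grind
        simp only [hiff, Function.update_self]
        exact ⟨hx, fun y hy => hy.2, hgx⟩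
  obtain ⟨enc, dec, h⟩ := key M le_rfl
  -- Unassigned outputs go to message 0, which can only reduce the error.
  refine ⟨fun w => enc w, fun y => if hy : dec y < M then ⟨dec y, hy⟩ else 0, fun w => ?_⟩
  obtain ⟨h1, -, h3⟩ := h w w.2
  refine ⟨h1, ?_⟩
  have hle : ∑ y, (if (if hy : dec y < M then (⟨dec y, hy⟩ : Fin M) else 0) ≠ w
      then W (enc w) y else 0) ≤
      ∑ y, (W (enc w) y - if dec y = w then W (enc w) y else 0) := by
    refine Finset.sum_le_sum fun y _ => ?_
    have := hW0 (enc w) y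
    by_cases hy : dec y = w
    · simp [hy]
    · simp only [hy, if_false, sub_zero]
      split_ifs <;> linarith
  rw [Finset.sum_sub_distrib, hW1] at hle
  linarith

/-- Change of measure: a bound on the number of correct decodings for any output distribution. -/
theorem sum_success_le {X Y : Type*} [Fintype Y] {M : ℕ} (W : X → Y → ℝ)
    (hW0 : ∀ x y, 0 ≤ W x y) (q : Y → ℝ) (hq0 : ∀ y, 0 ≤ q y) (hq1 : ∑ y, q y ≤ 1) {t : ℝ}
    (ht : 0 ≤ t) (enc : Fin M → X) (dec : Y → Fin M) :
    ∑ w, ∑ y, (if dec y = w then W (enc w) y else 0) ≤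
      ∑ w, ∑ y, (if t * q y < W (enc w) y then W (enc w) y else 0) + t := by
  -- A correctly decoded output either exceeds the threshold or has W ≤ t·q; the decoding regions
  -- are disjoint, so the second kind contributes at most t in total.
  have h1 : ∑ w, ∑ y, (if dec y = w then W (enc w) y else 0) ≤
      ∑ w, ∑ y, ((if t * q y < W (enc w) y then W (enc w) y else 0) +
        if dec y = w then t * q y else 0) := by
    refine Finset.sum_le_sum fun w _ => Finset.sum_le_sum fun y _ => ?_
    have h2 := hW0 (enc w) y
    have h3 := mul_nonneg ht (hq0 y)
    split_ifs <;> linarith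
  refine h1.trans ?_
  simp_rw [Finset.sum_add_distrib]
  gcongr
  rw [Finset.sum_comm]
  simp_rw [Finset.sum_ite_eq, Finset.mem_univ, if_true, ← Finset.mul_sum]
  nlinarith

/-! ### Memoryless channels -/

theorem sum_prod_eq_one {ι Y : Type*} [Fintype ι] [Fintype Y] [DecidableEq ι]
    (p : ι → Y → ℝ) (hp : ∀ j, ∑ y, p j y = 1) : ∑ y : ι → Y, ∏ j, p j (y j) = 1 := by
  have h := Finset.prod_univ_sum (fun _ : ι => (Finset.univ : Finset Y)) p
  rw [Fintype.piFinset_univ] at h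
  rw [← h]
  simp [hp]

theorem log_prod_div {ι : Type*} [Fintype ι] (u v : ι → ℝ) (hu : ∀ j, 0 < u j)
    (hv : ∀ j, 0 < v j) :
    ∑ j, Real.log (u j / v j) = Real.log (∏ j, u j) - Real.log (∏ j, v j) := by
  rw [Real.log_prod fun j _ => (hu j).ne', Real.log_prod fun j _ => (hv j).ne',
    ← Finset.sum_sub_distrib]
  exact Finset.sum_congr rfl fun j _ => Real.log_div (hu j).ne' (hv j).ne'

/-- Achievability for a memoryless channel: below the information `I(P, W)` (in nats) there are
block codes with letters in the support of `P`. -/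
theorem exists_block_codes {X Y : Type*} [Fintype X] [Fintype Y] (P : X → ℝ)
    (W : X → Y → ℝ) (hP0 : ∀ x, 0 ≤ P x) (hP1 : ∑ x, P x = 1) (hW0 : ∀ x y, 0 ≤ W x y)
    (hW1 : ∀ x, ∑ y, W x y = 1) {R : ℝ}
    (hR : R < ∑ x, P x * ∑ y, W x y * Real.log (W x y / ∑ x', P x' * W x' y)) :
    ∃ ρ : ℝ, 0 ≤ ρ ∧ ρ < 1 ∧ ∀ (m M : ℕ) [NeZero M],
      ∃ (enc : Fin M → Fin m → X) (dec : (Fin m → Y) → Fin M), ∀ w, (∀ j, 0 < P (enc w j)) ∧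
        ∑ y, (if dec y ≠ w then ∏ j, W (enc w j) (y j) else 0) ≤
          ρ ^ m + M / Real.exp (m * R) := by
  classical
  set q : Y → ℝ := fun y => ∑ x', P x' * W x' y with hq
  have h1 : ∑ ω : X × Y, P ω.1 * W ω.1 ω.2 = 1 := by
    rw [Fintype.sum_prod_type]
    simp_rw [← Finset.mul_sum, hW1, mul_one, hP1]
  have hmean : ∑ ω : X × Y, P ω.1 * W ω.1 ω.2 * (R - Real.log (W ω.1 ω.2 / q ω.2)) < 0 := by
    simp_rw [mul_sub]
    rw [Finset.sum_sub_distrib, ← Finset.sum_mul, h1, one_mul, Fintype.sum_prod_type, sub_neg]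
    simpa only [Finset.mul_sum, mul_assoc] using hR
  -- The pairs (letter, output) are identically distributed, so one trivial letter suffices; the
  -- mean of the exponent is R − I(P, W) < 0.
  obtain ⟨ρ, hρ0, hρ1, hρ⟩ := exists_chernoff_bound (A := Unit)
    (fun _ (ω : X × Y) => P ω.1 * W ω.1 ω.2) (fun _ ω => R - Real.log (W ω.1 ω.2 / q ω.2))
    (fun _ ω => mul_nonneg (hP0 _) (hW0 _ _)) (fun _ => h1) (fun _ => hmean)
  refine ⟨ρ, hρ0, hρ1, fun m M _ => ?_⟩
  obtain ⟨enc, dec, h⟩ := exists_code_of_threshold (fun x : Fin m → X => ∏ j, P (x j))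
    (fun x (y : Fin m → Y) => ∏ j, W (x j) (y j)) (fun x => Finset.prod_nonneg fun j _ => hP0 _)
    (sum_prod_eq_one (fun _ => P) fun _ => hP1)
    (fun x y => Finset.prod_nonneg fun j _ => hW0 _ _)
    (fun x => sum_prod_eq_one (fun j => W (x j)) fun _ => hW1 _) (Real.exp_pos (m * R)) M
  refine ⟨enc, dec, fun w => ⟨fun j => ?_, (h w).2.trans ?_⟩⟩
  · refine (hP0 _).lt_of_ne' fun h0 => (h w).1.ne' (Finset.prod_eq_zero (Finset.mem_univ j) h0)
  · gcongr
    have hout : ∀ y : Fin m → Y, ∑ x' : Fin m → X, (∏ j, P (x' j)) * ∏ j, W (x' j) (y j) =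
        ∏ j, q (y j) := by
      intro y
      simp_rw [← Finset.prod_mul_distrib, hq]
      rw [Finset.prod_univ_sum, Fintype.piFinset_univ]
    simp_rw [hout]
    refine le_trans (le_of_eq_of_le (b := ∑ ω : Fin m → X × Y,
      if ∏ j, W (ω j).1 (ω j).2 ≤ Real.exp (m * R) * ∏ j, q (ω j).2
        then (∏ j, P (ω j).1) * ∏ j, W (ω j).1 (ω j).2 else 0) ?_
      (Finset.sum_le_sum fun ω _ => ?_)) (hρ m fun _ => ())
    · rw [← Fintype.sum_prod_type']
      exact (Fintype.sum_equiv (Equiv.arrowProdEquivProdArrow (Fin m) (fun _ => X) fun _ => Y) _ _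
        fun ω => rfl).symm
    · rw [Finset.prod_mul_distrib]
      have hPn : ∀ j, 0 ≤ P (ω j).1 * W (ω j).1 (ω j).2 := fun j => mul_nonneg (hP0 _) (hW0 _ _)
      by_cases hpos : ∀ j, 0 < P (ω j).1 * W (ω j).1 (ω j).2
      · have hWp : ∀ j, 0 < W (ω j).1 (ω j).2 := fun j =>
          (pos_iff_pos_of_mul_pos (hpos j)).1 (pos_of_mul_pos_left (hpos j) (hW0 _ _))
        have hqp : ∀ j, 0 < q (ω j).2 := fun j => (hpos j).trans_le
          (Finset.single_le_sum (f := fun x' => P x' * W x' (ω j).2)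
            (fun x' _ => mul_nonneg (hP0 _) (hW0 _ _)) (Finset.mem_univ _))
        have hiff : ∏ j, W (ω j).1 (ω j).2 ≤ Real.exp (m * R) * ∏ j, q (ω j).2 →
            0 ≤ ∑ j, (R - Real.log (W (ω j).1 (ω j).2 / q (ω j).2)) := by
          intro hle
          have hl := Real.log_le_log (Finset.prod_pos fun j _ => hWp j) hle
          rw [Real.log_mul (Real.exp_pos _).ne' (Finset.prod_pos fun j _ => hqp j).ne',
            Real.log_exp] at hl
          rw [Finset.sum_sub_distrib, log_prod_div _ _ hWp hqp]
          simp only [Finset.sum_const, Finset.card_univ, Fintype.card_fin, nsmul_eq_mul]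
          linarith
        have hnn := Finset.prod_nonneg fun j (_ : j ∈ Finset.univ) => hPn j
        rw [Finset.prod_mul_distrib] at hnn
        split_ifs with h1 h2
        · exact le_rfl
        · exact absurd (hiff h1) h2
        · exact hnn
        · exact le_rfl
      · push Not at hpos
        obtain ⟨j, hj⟩ := hpos
        have hz : (∏ j, P (ω j).1) * ∏ j, W (ω j).1 (ω j).2 = 0 := by
          rw [← Finset.prod_mul_distrib]
          exact Finset.prod_eq_zero (Finset.mem_univ j) (le_antisymm hj (hPn j))
        simp [hz]

/-- Strong converse for a memoryless channel whose letters lie in `S`: above the largest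
divergence (in nats) of an output law from `q` the correct decoding probability decays. -/
theorem exists_block_converse {X Y : Type*} [Fintype X] [Fintype Y] (W : X → Y → ℝ)
    (hW0 : ∀ x y, 0 ≤ W x y) (hW1 : ∀ x, ∑ y, W x y = 1) (q : Y → ℝ) (hq0 : ∀ y, 0 ≤ q y)
    (hq1 : ∑ y, q y = 1) (S : Set X) (hS : S.Nonempty)
    (hqW : ∀ x ∈ S, ∀ y, 0 < W x y → 0 < q y) {R : ℝ}
    (hR : ∀ x ∈ S, ∑ y, W x y * Real.log (W x y / q y) < R) :
    ∃ ρ : ℝ, 0 ≤ ρ ∧ ρ < 1 ∧ ∀ (m M : ℕ) (enc : Fin M → Fin m → X)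
      (dec : (Fin m → Y) → Fin M), (∀ w j, enc w j ∈ S) →
        ∑ w, ∑ y, (if dec y = w then ∏ j, W (enc w j) (y j) else 0) ≤
          M * ρ ^ m + Real.exp (m * R) := by
  classical
  have : Nonempty S := hS.to_subtype
  -- Here the letters are the elements of `S`, so a single ρ serves all codewords, whatever their
  -- composition.
  obtain ⟨ρ, hρ0, hρ1, hρ⟩ := exists_chernoff_bound (A := S)
    (fun x y => W x y) (fun x y => Real.log (W x y / q y) - R)
    (fun _ _ => hW0 _ _) (fun _ => hW1 _) (fun x => by
      simp_rw [mul_sub]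
      rw [Finset.sum_sub_distrib, ← Finset.sum_mul, hW1, one_mul, sub_neg]
      exact hR x x.2)
  refine ⟨ρ, hρ0, hρ1, fun m M enc dec henc => ?_⟩
  have hqm : ∑ y : Fin m → Y, ∏ j, q (y j) = 1 := sum_prod_eq_one (fun _ => q) fun _ => hq1
  have hmain := sum_success_le (fun (x : Fin m → X) (y : Fin m → Y) => ∏ j, W (x j) (y j))
    (fun x y => Finset.prod_nonneg fun j _ => hW0 _ _) (fun y => ∏ j, q (y j))
    (fun y => Finset.prod_nonneg fun j _ => hq0 _) hqm.le
    (Real.exp_pos (m * R)).le enc dec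
  refine hmain.trans ?_
  have hw : ∀ w ∈ (Finset.univ : Finset (Fin M)),
      ∑ y : Fin m → Y, (if Real.exp (m * R) * ∏ j, q (y j) < ∏ j, W (enc w j) (y j)
        then ∏ j, W (enc w j) (y j) else 0) ≤ ρ ^ m := by
    intro w _
    refine le_trans (Finset.sum_le_sum fun y _ => ?_) (hρ m fun j => ⟨enc w j, henc w j⟩)
    by_cases hpos : ∀ j, 0 < W (enc w j) (y j)
    · have hqp : ∀ j, 0 < q (y j) := fun j => hqW _ (henc w j) _ (hpos j)
      have hiff : Real.exp (m * R) * ∏ j, q (y j) < ∏ j, W (enc w j) (y j) →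
          0 ≤ ∑ j, (Real.log (W (enc w j) (y j) / q (y j)) - R) := by
        intro hlt
        have hqq := Finset.prod_pos fun j (_ : j ∈ Finset.univ) => hqp j
        have hl := Real.log_le_log (mul_pos (Real.exp_pos _) hqq) hlt.le
        rw [Real.log_mul (Real.exp_pos _).ne' hqq.ne', Real.log_exp] at hl
        rw [Finset.sum_sub_distrib, log_prod_div _ _ hpos hqp]
        simp only [Finset.sum_const, Finset.card_univ, Fintype.card_fin, nsmul_eq_mul]
        linarith
      have hnn := Finset.prod_nonneg fun j (_ : j ∈ Finset.univ) => (hpos j).le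
      split_ifs with h1 h2
      · exact le_rfl
      · exact absurd (hiff h1) h2
      · exact hnn
      · exact le_rfl
    · push Not at hpos
      obtain ⟨j, hj⟩ := hpos
      have hz : ∏ j, W (enc w j) (y j) = 0 :=
        Finset.prod_eq_zero (Finset.mem_univ j) (le_antisymm hj (hW0 _ _))
      simp [hz]
  have := Finset.sum_le_sum hw
  rw [Finset.sum_const, Finset.card_univ, Fintype.card_fin, nsmul_eq_mul] at this
  exact add_le_add_left this _


/-! ### Information measures of a block of two channel uses -/

theorem sum_fin_two_arrow {A : Type*} [Fintype A] (F : (Fin 2 → A) → ℝ) :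
    ∑ f, F f = ∑ a, ∑ b, F ![a, b] := by
  rw [← Fintype.sum_prod_type']
  exact Fintype.sum_equiv (finTwoArrowEquiv A) _ _ fun f => by
    congr 1
    ext i
    fin_cases i <;> rfl

theorem becN_two (α : ℝ) (a b : Fin 2) (c d : Option (Fin 2)) :
    becN α ![a, b] ![c, d] = bec α a c * bec α b d := by
  simp [becN]

theorem bec_nonneg {α : ℝ} (h0 : 0 ≤ α) (h1 : α ≤ 1) (x : Fin 2) (y : Option (Fin 2)) :
    0 ≤ bec α x y := by
  rcases y with _ | y
  · exact h0
  · simp only [bec]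
    split_ifs <;> linarith

theorem sum_bec (α : ℝ) (x : Fin 2) : ∑ y, bec α x y = 1 := by
  simp [Fintype.sum_option, bec]

theorem becN_nonneg {α : ℝ} (h0 : 0 ≤ α) (h1 : α ≤ 1) {n : ℕ} (x : Fin n → Fin 2)
    (y : Fin n → Option (Fin 2)) : 0 ≤ becN α x y :=
  Finset.prod_nonneg fun _ _ => bec_nonneg h0 h1 _ _

theorem sum_becN (α : ℝ) {n : ℕ} (x : Fin n → Fin 2) : ∑ y, becN α x y = 1 :=
  sum_prod_eq_one (fun i => bec α (x i)) fun _ => sum_bec α _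

theorem mul_logb_two (x : ℝ) : x * Real.logb 2 x = -(Real.negMulLog x / Real.log 2) := by
  rw [Real.negMulLog, Real.logb]
  ring

theorem h₂_eq (p : ℝ) :
    h₂ p = (Real.negMulLog p + Real.negMulLog (1 - p)) / Real.log 2 := by
  simp only [h₂, Real.negMulLog, Real.logb]
  ring

theorem entropy_eq {A : Type*} [Fintype A] (p : A → ℝ) :
    entropy p = (∑ a, Real.negMulLog (p a)) / Real.log 2 := by
  rw [entropy, Finset.sum_div, ← Finset.sum_neg_distrib]
  exact Finset.sum_congr rfl fun a _ => by rw [mul_logb_two, neg_neg]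

theorem mutualInfo_eq {A B : Type*} [Fintype A] [Fintype B] (r : A → B → ℝ)
    (hr : ∀ a b, 0 ≤ r a b) :
    mutualInfo r = entropy (fun b => ∑ a, r a b) - condEntropy r := by
  have h : ∀ a b, r a b * Real.logb 2 (r a b / ((∑ b', r a b') * ∑ a', r a' b)) =
      r a b * Real.logb 2 (r a b / ∑ b', r a b') - r a b * Real.logb 2 (∑ a', r a' b) := by
    intro a b
    rcases (hr a b).eq_or_lt with h0 | h0
    · simp [← h0]
    · have hB : 0 < ∑ b', r a b' := h0.trans_le
        (Finset.single_le_sum (f := fun b' => r a b') (fun _ _ => hr _ _) (Finset.mem_univ b))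
      have hA : 0 < ∑ a', r a' b := h0.trans_le
        (Finset.single_le_sum (f := fun a' => r a' b) (fun _ _ => hr _ _) (Finset.mem_univ a))
      rw [← div_div, Real.logb_div (div_pos h0 hB).ne' hA.ne', mul_sub]
  rw [mutualInfo, entropy, condEntropy]
  simp_rw [h, Finset.sum_sub_distrib]
  rw [Finset.sum_comm (f := fun a b => r a b * Real.logb 2 (∑ a', r a' b))]
  simp_rw [← Finset.sum_mul]
  ring

theorem blockInfo_eq_sub {α : ℝ} (h0 : 0 ≤ α) (h1 : α ≤ 1) {P : (Fin 2 → Fin 2) → ℝ}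
    (hP : P ∈ blockInputs) :
    blockInfo α P = blockOutEntropy α P - blockCondEntropy α P :=
  mutualInfo_eq _ fun x _ => mul_nonneg (hP.1.1 x) (becN_nonneg h0 h1 _ _)

/-- Given any input, only the two erasures are random. -/
theorem blockCondEntropy_eq (α : ℝ) {P : (Fin 2 → Fin 2) → ℝ} (hP : P ∈ blockInputs) :
    blockCondEntropy α P = 2 * h₂ α := by
  have hW : ∀ x : Fin 2 → Fin 2, ∑ y, Real.negMulLog (becN α x y) =
      2 * (Real.negMulLog α + Real.negMulLog (1 - α)) := by
    intro x
    obtain ⟨a, b, rfl⟩ : ∃ a b, x = ![a, b] := ⟨x 0, x 1, by ext i; fin_cases i <;> rfl⟩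
    rw [sum_fin_two_arrow]
    simp_rw [becN_two, Real.negMulLog_mul, Finset.sum_add_distrib, ← Finset.mul_sum,
      ← Finset.sum_mul, sum_bec]
    have : ∀ a, ∑ c, Real.negMulLog (bec α a c) = Real.negMulLog α + Real.negMulLog (1 - α) := by
      intro a
      simp [Fintype.sum_option, bec, apply_ite Real.negMulLog]
    simp_rw [one_mul, this]
    ring
  have hx : ∀ x, ∑ y, blockJoint α P x y *
      Real.logb 2 (blockJoint α P x y / ∑ y', blockJoint α P x y') = -(P x * (2 * h₂ α)) := by
    intro x
    have hs : ∑ y', blockJoint α P x y' = P x := by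
      simp_rw [blockJoint, ← Finset.mul_sum, sum_becN, mul_one]
    rw [hs, h₂_eq, ← mul_div_assoc, ← hW x, Finset.sum_div, Finset.mul_sum,
      ← Finset.sum_neg_distrib]
    refine Finset.sum_congr rfl fun y _ => ?_
    rcases eq_or_ne (P x) 0 with hz | hz
    · simp [blockJoint, hz]
    · rw [blockJoint, mul_div_cancel_left₀ _ hz, mul_assoc, mul_logb_two]
      ring
  rw [blockCondEntropy, condEntropy]
  simp_rw [hx]
  rw [Finset.sum_neg_distrib, neg_neg, ← Finset.sum_mul, hP.1.2, one_mul]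

/-- Chain rule over the erasure pattern: the pattern contributes 2h₂(α), no erasure reveals X², and
a single erasure reveals one coordinate. Since (1,1) is excluded, P(1,0) and P(0,1) are the
probabilities of X₁ = 1 and X₂ = 1. -/
theorem blockOutEntropy_eq (α : ℝ) {P : (Fin 2 → Fin 2) → ℝ} (hP : P ∈ blockInputs) :
    blockOutEntropy α P = 2 * h₂ α +
      ((1 - α) ^ 2 * (Real.negMulLog (P ![0, 0]) + Real.negMulLog (P ![0, 1]) +
          Real.negMulLog (P ![1, 0])) +
        α * (1 - α) * (Real.negMulLog (P ![1, 0]) + Real.negMulLog (1 - P ![1, 0]) +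
          Real.negMulLog (P ![0, 1]) + Real.negMulLog (1 - P ![0, 1]))) / Real.log 2 := by
  have hs := hP.1.2
  rw [sum_fin_two_arrow] at hs
  simp only [Fin.sum_univ_two, hP.2, add_zero] at hs
  have e1 : 1 - P ![1, 0] = P ![0, 0] + P ![0, 1] := by linarith
  have e2 : 1 - P ![0, 1] = P ![0, 0] + P ![1, 0] := by linarith
  have hee : P ![0, 0] * (α * α) + P ![0, 1] * (α * α) + P ![1, 0] * (α * α) = α * α := by
    linear_combination (α * α) * hs
  rw [e1, e2, blockOutEntropy, entropy_eq, sum_fin_two_arrow]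
  simp_rw [blockJoint, sum_fin_two_arrow, becN_two]
  simp [Fintype.sum_option, Fin.sum_univ_two, bec, hP.2]
  rw [hee, show P ![0, 0] * (α * (1 - α)) + P ![1, 0] * (α * (1 - α)) =
      α * (1 - α) * (P ![0, 0] + P ![1, 0]) by ring,
    show P ![0, 0] * ((1 - α) * α) + P ![0, 1] * ((1 - α) * α) =
      α * (1 - α) * (P ![0, 0] + P ![0, 1]) by ring]
  simp only [Real.negMulLog_mul, h₂_eq]
  have h00 : P ![0, 0] = 1 - P ![0, 1] - P ![1, 0] := by linarith
  field_simp
  generalize Real.negMulLog (P ![0, 0]) = a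
  generalize Real.negMulLog (P ![0, 0] + P ![0, 1]) = b
  generalize Real.negMulLog (P ![0, 0] + P ![1, 0]) = c
  rw [h00]
  ring

theorem blockInfo_eq {α : ℝ} (h0 : 0 ≤ α) (h1 : α ≤ 1) {P : (Fin 2 → Fin 2) → ℝ}
    (hP : P ∈ blockInputs) :
    blockInfo α P =
      ((1 - α) ^ 2 * (Real.negMulLog (P ![0, 0]) + Real.negMulLog (P ![0, 1]) +
          Real.negMulLog (P ![1, 0])) +
        α * (1 - α) * (Real.negMulLog (P ![1, 0]) + Real.negMulLog (1 - P ![1, 0]) +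
          Real.negMulLog (P ![0, 1]) + Real.negMulLog (1 - P ![0, 1]))) / Real.log 2 := by
  rw [blockInfo_eq_sub h0 h1 hP, blockOutEntropy_eq α hP, blockCondEntropy_eq α hP]
  ring

/-! ### Symmetric inputs -/

theorem symInput_zero_zero (π : ℝ) : symInput π ![0, 0] = 1 - 2 * π := by simp [symInput]

theorem symInput_zero_one (π : ℝ) : symInput π ![0, 1] = π := by
  simp [symInput]

theorem symInput_one_zero (π : ℝ) : symInput π ![1, 0] = π := by
  simp [symInput]

theorem symInput_one_one (π : ℝ) : symInput π ![1, 1] = 0 := by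
  simp [symInput]

theorem symInput_mem {π : ℝ} (h0 : 0 ≤ π) (h1 : π ≤ 1 / 2) : symInput π ∈ blockInputs := by
  refine ⟨⟨fun x => ?_, ?_⟩, symInput_one_one π⟩
  · simp only [symInput]
    split_ifs <;> linarith
  · rw [sum_fin_two_arrow]
    simp only [Fin.sum_univ_two, symInput_zero_zero, symInput_zero_one, symInput_one_zero,
      symInput_one_one]
    ring

theorem blockInfo_symInput {α : ℝ} (h0 : 0 ≤ α) (h1 : α ≤ 1) {π : ℝ} (hπ0 : 0 ≤ π)
    (hπ1 : π ≤ 1 / 2) :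
    blockInfo α (symInput π) =
      (1 - α) ^ 2 * (h₂ (2 * π) + 2 * π) + 2 * α * (1 - α) * h₂ π := by
  have hlog : Real.log 2 ≠ 0 := (Real.log_pos one_lt_two).ne'
  have h2 : Real.negMulLog 2 = -2 * Real.log 2 := rfl
  rw [blockInfo_eq h0 h1 (symInput_mem hπ0 hπ1)]
  simp only [symInput_zero_zero, symInput_zero_one, symInput_one_zero, h₂_eq, Real.negMulLog_mul,
    h2]
  field_simp
  ring

/-! ### The optimality condition -/

/-- The Kuhn–Tucker condition for the symmetric input `symInput π`. -/
def Balanced (α π : ℝ) : Prop :=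
  (1 - α) ^ 2 * (Real.log (1 - 2 * π) - Real.log π) +
    α * (1 - α) * (Real.log (1 - π) - Real.log π) = 0

/-- The divergence (in nats) from the output law of `symInput π` of the output law of `(0, 0)`. -/
def blockDiv (α π : ℝ) : ℝ :=
  -((1 - α) ^ 2 * Real.log (1 - 2 * π)) - 2 * α * (1 - α) * Real.log (1 - π)

/-- Before normalisation by log 2, the two sides differ by 2π times the left side of `Balanced`. -/
theorem blockInfo_symInput_of_balanced {α : ℝ} (h0 : 0 ≤ α) (h1 : α ≤ 1) {π : ℝ} (hπ0 : 0 ≤ π)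
    (hπ1 : π ≤ 1 / 2) (hb : Balanced α π) :
    blockInfo α (symInput π) = blockDiv α π / Real.log 2 := by
  rw [blockInfo_eq h0 h1 (symInput_mem hπ0 hπ1)]
  simp only [symInput_zero_zero, symInput_zero_one, symInput_one_zero, Real.negMulLog, blockDiv]
  congr 1
  rw [Balanced] at hb
  linear_combination (2 * π) * hb

/-- The tangent at q to the concave function `negMulLog`, from log z ≤ z − 1 at z = q/p. -/
theorem negMulLog_le {p q : ℝ} (hp : 0 ≤ p) (hq : 0 < q) :
    Real.negMulLog p ≤ -p * Real.log q + q - p := by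
  rcases hp.eq_or_lt with rfl | hp
  · simpa using hq.le
  · have := Real.log_le_sub_one_of_pos (div_pos hq hp)
    rw [Real.log_div hq.ne' hp.ne'] at this
    have h2 := mul_le_mul_of_nonneg_left this hp.le
    rw [mul_sub, mul_sub, mul_div_cancel₀ _ hp.ne'] at h2
    rw [Real.negMulLog]
    linarith

theorem negMulLog_lt {p q : ℝ} (hp : 0 ≤ p) (hq : 0 < q) (hpq : p ≠ q) :
    Real.negMulLog p < -p * Real.log q + q - p := by
  rcases hp.eq_or_lt with rfl | hp
  · simpa using hq
  · have := Real.log_lt_sub_one_of_pos (div_pos hq hp)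
      fun h => hpq ((div_eq_one_iff_eq hp.ne').1 h).symm
    rw [Real.log_div hq.ne' hp.ne'] at this
    have h2 := mul_lt_mul_of_pos_left this hp
    rw [mul_sub, mul_sub, mul_div_cancel₀ _ hp.ne'] at h2
    rw [Real.negMulLog]
    linarith

theorem blockInputs_le_one {P : (Fin 2 → Fin 2) → ℝ} (hP : P ∈ blockInputs) (x : Fin 2 → Fin 2) :
    P x ≤ 1 := by
  rw [← hP.1.2]
  exact Finset.single_le_sum (fun x _ => hP.1.1 x) (Finset.mem_univ x)

theorem blockInputs_ext {P Q : (Fin 2 → Fin 2) → ℝ} (hP : P ∈ blockInputs) (hQ : Q ∈ blockInputs)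
    (h00 : P ![0, 0] = Q ![0, 0]) (h01 : P ![0, 1] = Q ![0, 1]) (h10 : P ![1, 0] = Q ![1, 0]) :
    P = Q := by
  funext x
  obtain ⟨a, b, rfl⟩ : ∃ a b, x = ![a, b] := ⟨x 0, x 1, by ext i; fin_cases i <;> rfl⟩
  fin_cases a <;> fin_cases b
  exacts [h00, h01, h10, hP.2.trans hQ.2.symm]

/-- Each `negMulLog` in the information lies below its tangent at `symInput π`, and `Balanced` makes
the sum of the tangents constant. The three gaps of the erasure-free term are kept on the left: for
α < 1 equality forces them to vanish, which yields uniqueness even at α = 0. -/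
theorem blockInfo_mul_log_two_add_le {α : ℝ} (h0 : 0 ≤ α) (h1 : α ≤ 1) {π : ℝ} (hπ0 : 0 < π)
    (hπ1 : π < 1 / 2) (hb : Balanced α π) {P : (Fin 2 → Fin 2) → ℝ} (hP : P ∈ blockInputs) :
    blockInfo α P * Real.log 2 + (1 - α) ^ 2 *
      ((-P ![0, 0] * Real.log (1 - 2 * π) + (1 - 2 * π) - P ![0, 0] -
          Real.negMulLog (P ![0, 0])) +
        (-P ![0, 1] * Real.log π + π - P ![0, 1] - Real.negMulLog (P ![0, 1])) +
        (-P ![1, 0] * Real.log π + π - P ![1, 0] - Real.negMulLog (P ![1, 0]))) ≤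
      blockDiv α π := by
  have hlog : Real.log 2 ≠ 0 := (Real.log_pos one_lt_two).ne'
  rw [blockInfo_eq h0 h1 hP, div_mul_cancel₀ _ hlog]
  have hs := hP.1.2
  rw [sum_fin_two_arrow] at hs
  simp only [Fin.sum_univ_two, hP.2, add_zero] at hs
  have hα : 0 ≤ α * (1 - α) := mul_nonneg h0 (by linarith)
  have k1 := negMulLog_le (hP.1.1 ![1, 0]) hπ0
  have k2 := negMulLog_le (hP.1.1 ![0, 1]) hπ0
  have k3 := negMulLog_le (sub_nonneg.2 (blockInputs_le_one hP ![1, 0]))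
    (by linarith : 0 < 1 - π)
  have k4 := negMulLog_le (sub_nonneg.2 (blockInputs_le_one hP ![0, 1]))
    (by linarith : 0 < 1 - π)
  have k := mul_le_mul_of_nonneg_left (add_le_add (add_le_add (add_le_add k1 k3) k2) k4) hα
  rw [Balanced] at hb
  have h00 : P ![0, 0] = 1 - P ![0, 1] - P ![1, 0] := by linarith
  rw [blockDiv]
  generalize Real.negMulLog (P ![0, 0]) = e0 at *
  rw [h00]
  -- The linearised bound exceeds `blockDiv` by P(0,1) + P(1,0) times the balance condition.
  have hb' := congrArg (fun z => (P ![0, 1] + P ![1, 0]) * z) hb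
  simp only [mul_zero] at hb'
  linarith

theorem blockInfo_le {α : ℝ} (h0 : 0 ≤ α) (h1 : α ≤ 1) {π : ℝ} (hπ0 : 0 < π)
    (hπ1 : π < 1 / 2) (hb : Balanced α π) {P : (Fin 2 → Fin 2) → ℝ} (hP : P ∈ blockInputs) :
    blockInfo α P ≤ blockInfo α (symInput π) := by
  rw [blockInfo_symInput_of_balanced h0 h1 hπ0.le hπ1.le hb,
    le_div_iff₀ (Real.log_pos one_lt_two)]
  refine le_trans (le_add_of_nonneg_right (mul_nonneg (sq_nonneg _) ?_))
    (blockInfo_mul_log_two_add_le h0 h1 hπ0 hπ1 hb hP)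
  have k0 := negMulLog_le (hP.1.1 ![0, 0]) (by linarith : 0 < 1 - 2 * π)
  have k1 := negMulLog_le (hP.1.1 ![0, 1]) hπ0
  have k2 := negMulLog_le (hP.1.1 ![1, 0]) hπ0
  linarith

theorem eq_symInput_of_blockInfo_eq {α : ℝ} (h0 : 0 ≤ α) (h1 : α < 1) {π : ℝ} (hπ0 : 0 < π)
    (hπ1 : π < 1 / 2) (hb : Balanced α π) {P : (Fin 2 → Fin 2) → ℝ} (hP : P ∈ blockInputs)
    (h : blockInfo α P = blockInfo α (symInput π)) : P = symInput π := by
  have key := blockInfo_mul_log_two_add_le h0 h1.le hπ0 hπ1 hb hP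
  rw [h, blockInfo_symInput_of_balanced h0 h1.le hπ0.le hπ1.le hb,
    div_mul_cancel₀ _ (Real.log_pos one_lt_two).ne', add_le_iff_nonpos_right] at key
  have key := nonpos_of_mul_nonpos_right key (by have := sub_pos.2 h1; positivity)
  have q0 : 0 < 1 - 2 * π := by linarith
  have k0 := negMulLog_le (hP.1.1 ![0, 0]) q0
  have k1 := negMulLog_le (hP.1.1 ![0, 1]) hπ0
  have k2 := negMulLog_le (hP.1.1 ![1, 0]) hπ0
  refine blockInputs_ext hP (symInput_mem hπ0.le hπ1.le) ?_ ?_ ?_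
  · rw [symInput_zero_zero]
    by_contra hne
    linarith [negMulLog_lt (hP.1.1 ![0, 0]) q0 hne]
  · rw [symInput_zero_one]
    by_contra hne
    linarith [negMulLog_lt (hP.1.1 ![0, 1]) hπ0 hne]
  · rw [symInput_one_zero]
    by_contra hne
    linarith [negMulLog_lt (hP.1.1 ![1, 0]) hπ0 hne]

theorem isOptimalInput_iff {α : ℝ} (h0 : 0 ≤ α) (h1 : α < 1) {π : ℝ} (hπ0 : 0 < π)
    (hπ1 : π < 1 / 2) (hb : Balanced α π) (P : (Fin 2 → Fin 2) → ℝ) :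
    IsOptimalInput α P ↔ P = symInput π := by
  have hmem := symInput_mem hπ0.le hπ1.le
  constructor
  · rintro ⟨hP, hmax⟩
    exact eq_symInput_of_blockInfo_eq h0 h1 hπ0 hπ1 hb hP
      (le_antisymm (blockInfo_le h0 h1.le hπ0 hπ1 hb hP) (hmax hmem))
  · rintro rfl
    exact ⟨hmem, fun P hP => blockInfo_le h0 h1.le hπ0 hπ1 hb hP⟩

/-- The output law of a block with input `symInput π`. -/
def blockOut (α π : ℝ) (y : Fin 2 → Option (Fin 2)) : ℝ := ∑ x, symInput π x * becN α x y

/-- Here c is the probability of an erasure pattern and p that of the visible input symbols; c = 0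
covers α = 0 and α = 1. -/
theorem mul_log_mul_div (c p : ℝ) :
    c * Real.log (c / (c * p)) = -(c * Real.log p) := by
  rcases eq_or_ne c 0 with rfl | hc
  · simp
  · rw [← div_div, div_self hc, one_div, Real.log_inv]
    ring

/-- For (0,0) this is the definition of `blockDiv`; for (0,1) and (1,0) the difference from it is
exactly the balance condition. -/
theorem sum_becN_mul_log {α π : ℝ} (hb : Balanced α π)
    {x : Fin 2 → Fin 2} (hx : x ≠ ![1, 1]) :
    ∑ y, becN α x y * Real.log (becN α x y / blockOut α π y) = blockDiv α π := by
  obtain ⟨a, b, rfl⟩ : ∃ a b, x = ![a, b] := ⟨x 0, x 1, by ext i; fin_cases i <;> rfl⟩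
  have e0 : (1 - 2 * π) * (α * α) + π * (α * α) + π * (α * α) = α * α * 1 := by ring
  have e1 : (1 - 2 * π) * (α * (1 - α)) + π * (α * (1 - α)) = α * (1 - α) * (1 - π) := by ring
  have e2 : (1 - 2 * π) * ((1 - α) * α) + π * ((1 - α) * α) = (1 - α) * α * (1 - π) := by ring
  have e3 : (1 - 2 * π) * ((1 - α) * (1 - α)) = (1 - α) * (1 - α) * (1 - 2 * π) := by ring
  have e4 : ∀ c, π * c = c * π := fun c => mul_comm _ _
  rw [Balanced] at hb
  simp_rw [blockOut, sum_fin_two_arrow, becN_two]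
  fin_cases a <;> fin_cases b
  · simp [Fintype.sum_option, Fin.sum_univ_two, bec, symInput_zero_zero, symInput_zero_one,
      symInput_one_zero, symInput_one_one]
    rw [e0, e1, e2, e3]
    simp only [mul_log_mul_div, Real.log_one, blockDiv]
    ring
  · simp [Fintype.sum_option, Fin.sum_univ_two, bec, symInput_zero_zero, symInput_zero_one,
      symInput_one_zero, symInput_one_one]
    rw [e0, e2, e4 (α * (1 - α)), e4 ((1 - α) * (1 - α))]
    simp only [mul_log_mul_div, Real.log_one, blockDiv]
    linear_combination hb
  · simp [Fintype.sum_option, Fin.sum_univ_two, bec, symInput_zero_zero, symInput_zero_one,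
      symInput_one_zero, symInput_one_one]
    rw [e0, e1, e4 ((1 - α) * α), e4 ((1 - α) * (1 - α))]
    simp only [mul_log_mul_div, Real.log_one, blockDiv]
    linear_combination hb
  · exact absurd rfl hx

/-! ### The stationarity equation -/

/-- Since 1 − x = (1 − 2π)/(1 − π), taking logarithms of x^(1/(1−α)) = 1 − x and clearing 1 − α,
nonzero here, gives the balance condition. -/
theorem stationary_iff_balanced {α : ℝ} (h1 : α < 1) {π : ℝ} (hπ0 : 0 < π) (hπ1 : π < 1 / 2) :
    Stationary α π ↔ Balanced α π := by
  have q0 : 0 < 1 - 2 * π := by linarith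
  have q1 : 0 < 1 - π := by linarith
  have ha : 0 < 1 - α := by linarith
  have hx : 0 < π / (1 - π) := div_pos hπ0 q1
  have hx1 : 1 - π / (1 - π) = (1 - 2 * π) / (1 - π) := by field_simp; ring
  have hs : Stationary α π ↔ (π / (1 - π)) ^ (1 / (1 - α)) = (1 - 2 * π) / (1 - π) := by
    rw [Stationary, ← hx1]
    constructor <;> intro h <;> linarith
  rw [hs, ← Real.log_injOn_pos.eq_iff (Set.mem_Ioi.2 (Real.rpow_pos_of_pos hx _))
    (Set.mem_Ioi.2 (div_pos q0 q1)), Real.log_rpow hx, Real.log_div hπ0.ne' q1.ne',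
    Real.log_div q0.ne' q1.ne', Balanced, one_div, inv_mul_eq_iff_eq_mul₀ ha.ne']
  constructor
  · intro h
    linear_combination (-(1 - α)) * h
  · intro h
    apply mul_left_cancel₀ ha.ne'
    linear_combination -h

theorem existsUnique_stationary {α : ℝ} (h1 : α < 1) :
    ∃! π : ℝ, π ∈ Set.Ioo (0 : ℝ) (1 / 2) ∧ Stationary α π := by
  have hr : 0 < 1 / (1 - α) := one_div_pos.2 (by linarith)
  set r := 1 / (1 - α) with hrdef
  have hmono : StrictMonoOn (fun x : ℝ => x ^ r + x) (Set.Ici 0) := fun x hx y hy hxy =>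
    add_lt_add (Real.rpow_lt_rpow hx hxy hr) hxy
  have hcont : ContinuousOn (fun x : ℝ => x ^ r + x) (Set.Icc 0 1) :=
    ((Real.continuous_rpow_const hr.le).add continuous_id).continuousOn
  obtain ⟨x, ⟨hx0, hx1⟩, hx⟩ := intermediate_value_Ioo zero_le_one hcont
    (show (1 : ℝ) ∈ Set.Ioo _ _ by simp [Real.zero_rpow hr.ne'])
  have hx : x ^ r + x = 1 := hx
  -- Inverse of x = π/(1 − π), carrying (0,1) to (0,1/2).
  refine ⟨x / (1 + x), ⟨⟨by positivity, ?_⟩, ?_⟩, ?_⟩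
  · rw [div_lt_div_iff₀ (by linarith) two_pos]
    linarith
  · have : x / (1 + x) / (1 - x / (1 + x)) = x := by
      have : 1 + x ≠ 0 := by positivity
      field_simp
      ring
    rw [Stationary, this, ← hrdef]
    linarith
  · rintro π ⟨⟨hπ0, hπ1⟩, hs⟩
    have q1 : 0 < 1 - π := by linarith
    have hs : (π / (1 - π)) ^ r + π / (1 - π) = x ^ r + x := by
      rw [Stationary, ← hrdef] at hs
      linarith
    have := hmono.injOn (Set.mem_Ici.2 (div_pos hπ0 q1).le) (Set.mem_Ici.2 hx0.le) hs
    rw [← this]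
    field_simp
    ring

theorem exists_balanced {α : ℝ} (h1 : α ≤ 1) :
    ∃ π : ℝ, 0 < π ∧ π < 1 / 2 ∧ Balanced α π := by
  rcases h1.eq_or_lt with rfl | h1
  -- At α = 1 the condition is vacuous, and any point of the interval serves.
  · exact ⟨1 / 4, by norm_num, by norm_num, by simp [Balanced]⟩
  · obtain ⟨π, ⟨⟨h0, hlt⟩, hs⟩, -⟩ := existsUnique_stationary h1
    exact ⟨π, h0, hlt, (stationary_iff_balanced h1 h0 hlt).1 hs⟩


/-! ### Feasible sequences and their blocks -/

theorem symbolAt_nonneg {n : ℕ} (x : Fin n → Fin 2) (t : ℕ) : 0 ≤ symbolAt x t := by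
  unfold symbolAt
  split_ifs <;> omega

theorem symbolAt_le_one {n : ℕ} (x : Fin n → Fin 2) (t : ℕ) : symbolAt x t ≤ 1 := by
  unfold symbolAt
  split_ifs <;> omega

theorem symbolAt_of_lt {n : ℕ} (x : Fin n → Fin 2) {t : ℕ} (h : n < t) : symbolAt x t = 0 :=
  dif_neg (by omega)

theorem symbolAt_succ {n : ℕ} (x : Fin n → Fin 2) (i : Fin n) :
    symbolAt x (i + 1) = ((x i : ℕ) : ℤ) := by
  rw [symbolAt, dif_pos ⟨by omega, by omega⟩]
  rfl

theorem battery_even {n : ℕ} (x : Fin n → Fin 2) (j : ℕ) :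
    battery x (2 * j + 2) = min (battery x (2 * j + 1) - symbolAt x (2 * j + 1)) 1 := by
  have : ¬ Odd (2 * j + 1 + 1) := by rw [Nat.odd_iff]; omega
  rw [battery, arrival, if_neg this, add_zero]

theorem battery_odd {n : ℕ} (x : Fin n → Fin 2) (j : ℕ) :
    battery x (2 * j + 3) = min (battery x (2 * j + 2) - symbolAt x (2 * j + 2) + 1) 1 := by
  have : Odd (2 * j + 2 + 1) := by rw [Nat.odd_iff]; omega
  rw [battery, arrival, if_pos this]

theorem battery_one {n : ℕ} (x : Fin n → Fin 2) : battery x 1 = 1 := by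
  simp [battery, arrival, symbolAt]

theorem battery_le_one {n : ℕ} (x : Fin n → Fin 2) (t : ℕ) : battery x t ≤ 1 := by
  cases t with
  | zero => simp [battery]
  | succ t => exact min_le_right _ _

/-- Feasibility restores B = 1 at each odd time, so only the two symbols of a pair interact. For odd
n the last symbol is paired with the default value 0. -/
theorem energyFeasible_iff {n : ℕ} (x : Fin n → Fin 2) :
    EnergyFeasible x ↔ ∀ j, symbolAt x (2 * j + 1) + symbolAt x (2 * j + 2) ≤ 1 := by
  constructor
  · intro h j
    by_cases hj : 2 * j + 2 ≤ n
    · have h1 := h (2 * j + 2) (by omega) hj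
      have h2 := battery_le_one x (2 * j + 1)
      rw [battery_even] at h1
      have := h1.trans (min_le_left _ _)
      omega
    · rw [symbolAt_of_lt x (by omega : n < 2 * j + 2), add_zero]
      exact symbolAt_le_one _ _
  · intro h
    have hodd : ∀ j, battery x (2 * j + 1) = 1 := by
      intro j
      induction j with
      | zero => exact battery_one x
      | succ j ih =>
        rw [show 2 * (j + 1) + 1 = 2 * j + 3 by ring, battery_odd, battery_even, ih]
        have := h j
        have := symbolAt_nonneg x (2 * j + 1)
        omega
    intro t ht _
    rcases Nat.even_or_odd' t with ⟨k, rfl | rfl⟩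
    · obtain ⟨j, rfl⟩ : ∃ j, k = j + 1 := ⟨k - 1, by omega⟩
      rw [show 2 * (j + 1) = 2 * j + 2 by ring, battery_even, hodd]
      have := h j
      have := symbolAt_nonneg x (2 * j + 1)
      rw [min_eq_left (by omega)]
      omega
    · rw [hodd]
      exact symbolAt_le_one _ _

/-- Cutting a sequence of length `2m` into `m` blocks of two. -/
def blocks {A : Type*} (m : ℕ) : (Fin (m * 2) → A) ≃ (Fin m → Fin 2 → A) :=
  (Equiv.arrowCongr finProdFinEquiv.symm (Equiv.refl A)).trans (Equiv.curry _ _ _)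

theorem blocks_apply {A : Type*} {m : ℕ} (x : Fin (m * 2) → A) (j : Fin m) (k : Fin 2) :
    blocks m x j k = x (finProdFinEquiv (j, k)) := rfl

theorem becN_eq_prod_blocks (α : ℝ) {m : ℕ} (x : Fin (m * 2) → Fin 2)
    (y : Fin (m * 2) → Option (Fin 2)) :
    becN α x y = ∏ j, becN α (blocks m x j) (blocks m y j) := by
  simp_rw [becN, blocks_apply]
  rw [← Fintype.prod_prod_type', ← Equiv.prod_comp finProdFinEquiv]

theorem energyFeasible_iff_blocks {m : ℕ} (x : Fin (m * 2) → Fin 2) :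
    EnergyFeasible x ↔ ∀ j, blocks m x j ≠ ![1, 1] := by
  have hsym : ∀ (j : Fin m), symbolAt x (2 * j + 1) + symbolAt x (2 * j + 2) ≤ 1 ↔
      blocks m x j ≠ ![1, 1] := by
    intro j
    have h0 := symbolAt_succ x (finProdFinEquiv (j, 0))
    have h1 := symbolAt_succ x (finProdFinEquiv (j, 1))
    rw [← blocks_apply x] at h0 h1
    simp only [finProdFinEquiv_apply_val, Fin.val_zero, Fin.val_one, zero_add] at h0 h1
    rw [h0, show 2 * (j : ℕ) + 2 = 1 + 2 * j + 1 by ring, h1]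
    generalize blocks m x j = b
    revert b
    decide
  rw [energyFeasible_iff]
  constructor
  · exact fun h j => (hsym j).1 (h j)
  · intro h j
    by_cases hj : j < m
    · exact (hsym ⟨j, hj⟩).2 (h _)
    · rw [symbolAt_of_lt x (by omega), symbolAt_of_lt x (by omega)]
      norm_num

theorem symbolAt_snoc_zero {n : ℕ} (x : Fin n → Fin 2) (t : ℕ) :
    symbolAt (Fin.snoc x 0 : Fin (n + 1) → Fin 2) t = symbolAt x t := by
  unfold symbolAt
  by_cases h : 1 ≤ t ∧ t ≤ n
  · rw [dif_pos h, dif_pos ⟨h.1, by omega⟩]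
    simp [Fin.snoc, show t - 1 < n by omega, Fin.castLT]
  · rw [dif_neg h]
    split_ifs with h'
    · simp [Fin.snoc, show ¬ t - 1 < n by omega]
    · rfl

theorem energyFeasible_snoc_zero {n : ℕ} {x : Fin n → Fin 2} (h : EnergyFeasible x) :
    EnergyFeasible (Fin.snoc x 0 : Fin (n + 1) → Fin 2) := by
  rw [energyFeasible_iff] at h ⊢
  simpa only [symbolAt_snoc_zero] using h

/-! ### Codes -/

theorem errorProb_nonneg {α : ℝ} (h0 : 0 ≤ α) (h1 : α ≤ 1) {M n : ℕ} (c : Code M n) :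
    0 ≤ errorProb α c := by
  refine div_nonneg (Finset.sum_nonneg fun w _ => Finset.sum_nonneg fun y _ => ?_)
    (Nat.cast_nonneg M)
  split_ifs
  · exact becN_nonneg h0 h1 _ _
  · exact le_rfl

/-- Sending a zero after each codeword. -/
def Code.extend {M n : ℕ} (c : Code M n) : Code M (n + 1) where
  enc w := Fin.snoc (c.enc w) 0
  dec y := c.dec (Fin.init y)
  feasible w := energyFeasible_snoc_zero (c.feasible w)

/-- The decoder ignores the last output, whose law sums to 1. -/
theorem errorProb_extend (α : ℝ) {M n : ℕ} (c : Code M n) :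
    errorProb α c.extend = errorProb α c := by
  unfold errorProb
  congr 1
  refine Finset.sum_congr rfl fun w _ => ?_
  rw [← Equiv.sum_comp (Fin.snocEquiv fun _ => Option (Fin 2)), Fintype.sum_prod_type,
    Finset.sum_comm]
  refine Finset.sum_congr rfl fun y _ => ?_
  have h : ∀ z, becN α (c.extend.enc w) (Fin.snocEquiv (fun _ => Option (Fin 2)) (z, y)) =
      becN α (c.enc w) y * bec α 0 z := by
    intro z
    simp [becN, Code.extend, Fin.prod_univ_castSucc, Fin.snocEquiv]
  have hd : ∀ z, c.extend.dec (Fin.snocEquiv (fun _ => Option (Fin 2)) (z, y)) = c.dec y := by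
    intro z
    simp [Code.extend, Fin.snocEquiv]
  simp_rw [h, hd]
  split_ifs
  · rw [← Finset.mul_sum, sum_bec, mul_one]
  · simp

/-- The code given by an encoder and a decoder that act on blocks of two. -/
def Code.ofBlocks {M m : ℕ} (enc : Fin M → Fin m → Fin 2 → Fin 2)
    (dec : (Fin m → Fin 2 → Option (Fin 2)) → Fin M) (h : ∀ w j, enc w j ≠ ![1, 1]) :
    Code M (m * 2) where
  enc w := (blocks m).symm (enc w)
  dec y := dec (blocks m y)
  feasible w := by
    rw [energyFeasible_iff_blocks, Equiv.apply_symm_apply]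
    exact h w

theorem errorProb_ofBlocks (α : ℝ) {M m : ℕ} (enc : Fin M → Fin m → Fin 2 → Fin 2)
    (dec : (Fin m → Fin 2 → Option (Fin 2)) → Fin M) (h : ∀ w j, enc w j ≠ ![1, 1]) :
    errorProb α (Code.ofBlocks enc dec h) = (∑ w, ∑ y : Fin m → Fin 2 → Option (Fin 2),
      if dec y ≠ w then ∏ j, becN α (enc w j) (y j) else 0) / M := by
  unfold errorProb
  congr 1
  refine Finset.sum_congr rfl fun w _ => ?_
  rw [← Equiv.sum_comp (blocks m)]
  simp_rw [becN_eq_prod_blocks, Code.ofBlocks, Equiv.apply_symm_apply]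

theorem exists_code_errorProb_eq_zero (α : ℝ) {M : ℕ} (hM : M = 1) (n : ℕ) :
    ∃ c : Code M n, errorProb α c = 0 := by
  subst hM
  refine ⟨⟨fun _ _ => 0, fun _ => 0, fun _ => ?_⟩, ?_⟩
  · rw [energyFeasible_iff]
    intro j
    have h : ∀ t, symbolAt (fun _ : Fin n => (0 : Fin 2)) t = 0 := fun t => by simp [symbolAt]
    simp [h]
  · simp [errorProb, Subsingleton.elim _ (0 : Fin 1)]

/-- Needed separately: for α = 1 the capacity is 0, and no nonnegative rate lies strictly below it.
-/
theorem achievable_zero (α : ℝ) : Achievable α 0 := by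
  choose c hc using fun n : ℕ => exists_code_errorProb_eq_zero α
    (M := ⌈(2 : ℝ) ^ ((n : ℝ) * 0)⌉₊) (by simp) n
  exact ⟨le_rfl, c, by simp [hc]⟩

/-! ### The capacity -/

theorem blockOut_nonneg {α : ℝ} (h0 : 0 ≤ α) (h1 : α ≤ 1) {π : ℝ} (hπ0 : 0 ≤ π)
    (hπ1 : π ≤ 1 / 2) (y : Fin 2 → Option (Fin 2)) : 0 ≤ blockOut α π y :=
  Finset.sum_nonneg fun x _ =>
    mul_nonneg ((symInput_mem hπ0 hπ1).1.1 x) (becN_nonneg h0 h1 _ _)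

theorem sum_blockOut (α : ℝ) {π : ℝ} (hπ0 : 0 ≤ π) (hπ1 : π ≤ 1 / 2) :
    ∑ y, blockOut α π y = 1 := by
  simp_rw [blockOut]
  rw [Finset.sum_comm]
  simp_rw [← Finset.mul_sum, sum_becN, mul_one]
  exact (symInput_mem hπ0 hπ1).1.2

theorem symInput_pos {π : ℝ} (hπ0 : 0 < π) (hπ1 : π < 1 / 2) {x : Fin 2 → Fin 2}
    (hx : x ≠ ![1, 1]) : 0 < symInput π x := by
  simp only [symInput, hx, if_false]
  split_ifs <;> linarith

theorem blockOut_pos {α : ℝ} (h0 : 0 ≤ α) (h1 : α ≤ 1) {π : ℝ} (hπ0 : 0 < π)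
    (hπ1 : π < 1 / 2) {x : Fin 2 → Fin 2} (hx : x ≠ ![1, 1]) {y : Fin 2 → Option (Fin 2)}
    (hy : 0 < becN α x y) : 0 < blockOut α π y :=
  (mul_pos (symInput_pos hπ0 hπ1 hx) hy).trans_le
    (Finset.single_le_sum (f := fun x => symInput π x * becN α x y)
      (fun x _ => mul_nonneg ((symInput_mem hπ0.le hπ1.le).1.1 x) (becN_nonneg h0 h1 _ _))
      (Finset.mem_univ x))

theorem sum_symInput_mul_eq_blockDiv {α π : ℝ} (hπ0 : 0 ≤ π) (hπ1 : π ≤ 1 / 2)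
    (hb : Balanced α π) :
    ∑ x, symInput π x * ∑ y, becN α x y * Real.log (becN α x y / blockOut α π y) =
      blockDiv α π := by
  have h : ∀ x, symInput π x * ∑ y, becN α x y * Real.log (becN α x y / blockOut α π y) =
      symInput π x * blockDiv α π := by
    intro x
    rcases eq_or_ne x ![1, 1] with rfl | hx
    · simp [symInput_one_one]
    · rw [sum_becN_mul_log hb hx]
  simp_rw [h]
  rw [← Finset.sum_mul, (symInput_mem hπ0 hπ1).1.2, one_mul]

theorem tendsto_pow_half {r : ℝ} (h0 : 0 ≤ r) (h1 : r < 1) :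
    Filter.Tendsto (fun n : ℕ => r ^ (n / 2)) Filter.atTop (𝓝 0) :=
  (tendsto_pow_atTop_nhds_zero_of_lt_one h0 h1).comp
    (Filter.tendsto_atTop_atTop.2 fun b => ⟨2 * b, fun n hn => by omega⟩)

theorem exists_codes {α : ℝ} (h0 : 0 ≤ α) (h1 : α ≤ 1) {π : ℝ} (hπ0 : 0 < π)
    (hπ1 : π < 1 / 2) (hb : Balanced α π) {R : ℝ} (hR : R < blockDiv α π) :
    ∃ ρ : ℝ, 0 ≤ ρ ∧ ρ < 1 ∧ ∀ (n M : ℕ), 0 < M → ∃ c : Code M n,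
      errorProb α c ≤ ρ ^ (n / 2) + M / Real.exp ((n / 2 : ℕ) * R) := by
  have hmem := symInput_mem hπ0.le hπ1.le
  obtain ⟨ρ, hρ0, hρ1, h⟩ := exists_block_codes (symInput π)
    (fun (x : Fin 2 → Fin 2) y => becN α x y) hmem.1.1 hmem.1.2 (fun x y => becN_nonneg h0 h1 x y)
    (fun x => sum_becN α x) (R := R)
    (hR.trans_eq (sum_symInput_mul_eq_blockDiv hπ0.le hπ1.le hb).symm)
  refine ⟨ρ, hρ0, hρ1, fun n M hM => ?_⟩
  have heven : ∀ m, ∃ c : Code M (m * 2), errorProb α c ≤ ρ ^ m + M / Real.exp (m * R) := by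
    intro m
    have : NeZero M := ⟨hM.ne'⟩
    obtain ⟨enc, dec, hc⟩ := h m M
    refine ⟨Code.ofBlocks enc dec fun w j hw => ?_, ?_⟩
    · have := (hc w).1 j
      rw [hw, symInput_one_one] at this
      exact lt_irrefl _ this
    · rw [errorProb_ofBlocks, div_le_iff₀ (by exact_mod_cast hM)]
      refine (Finset.sum_le_sum fun w _ => (hc w).2).trans ?_
      rw [Finset.sum_const, Finset.card_univ, Fintype.card_fin, nsmul_eq_mul, mul_comm]
  have hc' := heven (n / 2)
  rcases Nat.mod_two_eq_zero_or_one n with hn | hn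
  · rwa [show n / 2 * 2 = n by omega] at hc'
  · obtain ⟨c, hc⟩ := hc'
    have hn : n / 2 * 2 + 1 = n := by omega
    have : ∃ c : Code M (n / 2 * 2 + 1),
        errorProb α c ≤ ρ ^ (n / 2) + M / Real.exp ((n / 2 : ℕ) * R) :=
      ⟨c.extend, (errorProb_extend α c).trans_le hc⟩
    rw [hn] at this
    exact this

theorem achievable_of_lt {α : ℝ} (h0 : 0 ≤ α) (h1 : α ≤ 1) {π : ℝ} (hπ0 : 0 < π)
    (hπ1 : π < 1 / 2) (hb : Balanced α π) {R : ℝ} (hR0 : 0 ≤ R)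
    (hR : R < blockDiv α π / (2 * Real.log 2)) : Achievable α R := by
  have hlog := Real.log_pos one_lt_two
  rw [lt_div_iff₀ (by positivity)] at hR
  obtain ⟨R', hRR', hR'⟩ := exists_between hR
  obtain ⟨ρ, hρ0, hρ1, h⟩ := exists_codes h0 h1 hπ0 hπ1 hb hR'
  choose c hc using fun n : ℕ => h n ⌈(2 : ℝ) ^ ((n : ℝ) * R)⌉₊
    (Nat.ceil_pos.2 (Real.rpow_pos_of_pos two_pos _))
  refine ⟨hR0, c, ?_⟩
  -- The 2 absorbs the ceiling, as 2^(nR) ≥ 1; the factor 2^R absorbs the unused symbol of an odd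
  -- length.
  set K := 2 * Real.exp (R * Real.log 2) with hK
  set r := Real.exp (R * (2 * Real.log 2) - R') with hr
  have hr1 : r < 1 := Real.exp_lt_one_iff.2 (by linarith)
  have hbound : ∀ n : ℕ, errorProb α (c n) ≤ ρ ^ (n / 2) + K * r ^ (n / 2) := by
    intro n
    refine (hc n).trans ?_
    gcongr
    rw [div_le_iff₀ (Real.exp_pos _)]
    have hge : (1 : ℝ) ≤ 2 ^ ((n : ℝ) * R) :=
      Real.one_le_rpow one_le_two (mul_nonneg (Nat.cast_nonneg n) hR0)
    have hceil := (Nat.ceil_lt_add_one (zero_le_one.trans hge)).le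
    have hn : (n : ℝ) ≤ 2 * (n / 2 : ℕ) + 1 := by exact_mod_cast (by omega : n ≤ 2 * (n / 2) + 1)
    have hpow : (2 : ℝ) ^ ((n : ℝ) * R) ≤
        Real.exp (R * Real.log 2) * r ^ (n / 2) * Real.exp ((n / 2 : ℕ) * R') := by
      rw [hr, ← Real.exp_nat_mul, ← Real.exp_add, ← Real.exp_add,
        Real.rpow_def_of_pos two_pos, Real.exp_le_exp]
      have := mul_le_mul_of_nonneg_left hn (mul_nonneg hR0 hlog.le)
      linarith
    rw [hK]
    linarith
  refine squeeze_zero (fun n => errorProb_nonneg h0 h1 _) hbound ?_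
  simpa using (tendsto_pow_half hρ0 hρ1).add
    ((tendsto_pow_half (Real.exp_pos _).le hr1).const_mul K)

theorem one_sub_errorProb_mul {α : ℝ} {M n : ℕ} (hM : 0 < M) (c : Code M n) :
    (1 - errorProb α c) * M = ∑ w, ∑ y, if c.dec y = w then becN α (c.enc w) y else 0 := by
  have hM' : (M : ℝ) ≠ 0 := by exact_mod_cast hM.ne'
  have h : (M : ℝ) = ∑ w, ∑ y, ((if c.dec y = w then becN α (c.enc w) y else 0) +
      if c.dec y ≠ w then becN α (c.enc w) y else 0) := by
    have h1 : ∀ w y, (if c.dec y = w then becN α (c.enc w) y else 0) +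
        (if c.dec y ≠ w then becN α (c.enc w) y else 0) = becN α (c.enc w) y := by
      intro w y
      by_cases h : c.dec y = w <;> simp [h]
    simp_rw [h1, sum_becN]
    simp
  simp_rw [Finset.sum_add_distrib] at h
  rw [sub_mul, errorProb, div_mul_cancel₀ _ hM', one_mul]
  linarith

theorem le_of_achievable {α : ℝ} (h0 : 0 ≤ α) (h1 : α ≤ 1) {π : ℝ} (hπ0 : 0 < π)
    (hπ1 : π < 1 / 2) (hb : Balanced α π) {R : ℝ} (hR : Achievable α R) :
    R ≤ blockDiv α π / (2 * Real.log 2) := by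
  by_contra! hlt
  have hlog := Real.log_pos one_lt_two
  rw [div_lt_iff₀ (by positivity)] at hlt
  obtain ⟨R', hR', hRR'⟩ := exists_between hlt
  obtain ⟨-, c, hc⟩ := hR
  obtain ⟨ρ, hρ0, hρ1, h⟩ := exists_block_converse (fun (x : Fin 2 → Fin 2) y => becN α x y)
    (fun x y => becN_nonneg h0 h1 x y) (fun x => sum_becN α x) (blockOut α π)
    (blockOut_nonneg h0 h1 hπ0.le hπ1.le) (sum_blockOut α hπ0.le hπ1.le) {x | x ≠ ![1, 1]}
    ⟨![0, 0], by decide⟩ (fun x hx y hy => blockOut_pos h0 h1 hπ0 hπ1 hx hy) (R := R')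
    (fun x hx => (sum_becN_mul_log hb hx).trans_lt hR')
  set r := Real.exp (R' - R * (2 * Real.log 2)) with hr
  have hr1 : r < 1 := Real.exp_lt_one_iff.2 (by linarith)
  -- Even lengths suffice for a contradiction: the success probability would tend to both 1 and 0.
  have hbound : ∀ m : ℕ, 1 - errorProb α (c (m * 2)) ≤ ρ ^ m + r ^ m := by
    intro m
    have hpos : (0 : ℝ) < 2 ^ (((m * 2 : ℕ) : ℝ) * R) := Real.rpow_pos_of_pos two_pos _
    have hM : 0 < ⌈(2 : ℝ) ^ (((m * 2 : ℕ) : ℝ) * R)⌉₊ := Nat.ceil_pos.2 hpos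
    have hM' : (0 : ℝ) < (⌈(2 : ℝ) ^ (((m * 2 : ℕ) : ℝ) * R)⌉₊ : ℝ) := by exact_mod_cast hM
    have hs := one_sub_errorProb_mul (α := α) hM (c (m * 2))
    have hle := h m _ (fun w => blocks m ((c (m * 2)).enc w))
      (fun y => (c (m * 2)).dec ((blocks m).symm y))
      (fun w => (energyFeasible_iff_blocks _).1 ((c (m * 2)).feasible w))
    have heq : ∑ w, ∑ y : Fin m → Fin 2 → Option (Fin 2),
        (if (c (m * 2)).dec ((blocks m).symm y) = w
          then ∏ j, becN α (blocks m ((c (m * 2)).enc w) j) (y j) else 0) =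
        ∑ w, ∑ y, if (c (m * 2)).dec y = w then becN α ((c (m * 2)).enc w) y else 0 := by
      refine Finset.sum_congr rfl fun w _ => ?_
      rw [← Equiv.sum_comp (blocks m)]
      simp_rw [becN_eq_prod_blocks, Equiv.symm_apply_apply]
    rw [heq, ← hs] at hle
    have hexp : Real.exp (m * R') ≤ ⌈(2 : ℝ) ^ (((m * 2 : ℕ) : ℝ) * R)⌉₊ * r ^ m := by
      refine le_trans (le_of_eq ?_)
        (mul_le_mul_of_nonneg_right (Nat.le_ceil _) (pow_nonneg (Real.exp_pos _).le m))
      rw [hr, ← Real.exp_nat_mul, Real.rpow_def_of_pos two_pos, ← Real.exp_add]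
      congr 1
      push_cast
      ring
    refine le_of_mul_le_mul_right (hle.trans ?_) hM'
    linarith
  have hlim : Filter.Tendsto (fun m : ℕ => 1 - errorProb α (c (m * 2))) Filter.atTop
      (𝓝 (1 - 0)) :=
    (hc.comp (Filter.tendsto_atTop_atTop.2 fun b => ⟨b, fun n hn => by omega⟩)).const_sub 1
  have hlim' : Filter.Tendsto (fun m : ℕ => ρ ^ m + r ^ m) Filter.atTop (𝓝 (0 + 0)) :=
    (tendsto_pow_atTop_nhds_zero_of_lt_one hρ0 hρ1).add
      (tendsto_pow_atTop_nhds_zero_of_lt_one (Real.exp_pos _).le hr1)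
  have := le_of_tendsto_of_tendsto' hlim hlim' hbound
  norm_num at this

theorem isLUB_achievable {α : ℝ} (h0 : 0 ≤ α) (h1 : α ≤ 1) {π : ℝ} (hπ0 : 0 < π)
    (hπ1 : π < 1 / 2) (hb : Balanced α π) :
    IsLUB {R : ℝ | Achievable α R} (blockDiv α π / (2 * Real.log 2)) := by
  refine ⟨fun R hR => le_of_achievable h0 h1 hπ0 hπ1 hb hR, fun b hub => ?_⟩
  refine le_of_forall_lt fun R hR => ?_
  obtain ⟨R', hRR', hR'⟩ := exists_between hR
  rcases le_or_gt 0 R' with hR0 | hR0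
  · exact hRR'.trans_le (hub (achievable_of_lt h0 h1 hπ0 hπ1 hb hR0 hR'))
  · exact (hRR'.trans hR0).trans_le (hub (achievable_zero α))

theorem capacity_eq_blockDiv {α : ℝ} (h0 : 0 ≤ α) (h1 : α ≤ 1) {π : ℝ} (hπ0 : 0 < π)
    (hπ1 : π < 1 / 2) (hb : Balanced α π) :
    capacity α = blockDiv α π / (2 * Real.log 2) :=
  (isLUB_achievable h0 h1 hπ0 hπ1 hb).csSup_eq ⟨0, achievable_zero α⟩

theorem capacity_eq_blockInfo {α : ℝ} (h0 : 0 ≤ α) (h1 : α ≤ 1) {π : ℝ} (hπ0 : 0 < π)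
    (hπ1 : π < 1 / 2) (hb : Balanced α π) :
    capacity α = 1 / 2 * blockInfo α (symInput π) := by
  rw [capacity_eq_blockDiv h0 h1 hπ0 hπ1 hb,
    blockInfo_symInput_of_balanced h0 h1 hπ0.le hπ1.le hb]
  field_simp

theorem isGreatest_blockInfo {α : ℝ} (h0 : 0 ≤ α) (h1 : α ≤ 1) :
    IsGreatest ((fun P => 1 / 2 * blockInfo α P) '' blockInputs) (capacity α) := by
  obtain ⟨π, hπ0, hπ1, hb⟩ := exists_balanced h1
  rw [capacity_eq_blockInfo h0 h1 hπ0 hπ1 hb]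
  refine ⟨⟨_, symInput_mem hπ0.le hπ1.le, rfl⟩, ?_⟩
  rintro _ ⟨P, hP, rfl⟩
  have := blockInfo_le h0 h1 hπ0 hπ1 hb hP
  simp only
  linarith


/-! ### Erasure probability one half -/

open Real in
-- Equivalent to 2^84 < φ^121 and φ^157 < 2^109, checked through φ^(n+1) = φ·F_(n+1) + F_n. The
-- fractions 84/121 and 109/157 enclose log₂ φ tightly enough for C(1/2) = (5/8) log₂ φ.
theorem goldenRatio_log_bounds :
    84 * Real.log 2 < 121 * Real.log goldenRatio ∧
      157 * Real.log goldenRatio < 109 * Real.log 2 := by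
  have hs : (2.236 : ℝ) < √5 := Real.lt_sqrt_of_sq_lt (by norm_num)
  have hs' : √5 < 2.2361 := (Real.sqrt_lt' (by norm_num)).2 (by norm_num)
  have hg : (1.618 : ℝ) < goldenRatio := by
    rw [goldenRatio]
    linarith
  have hg' : goldenRatio < 1.61805 := by
    rw [goldenRatio]
    linarith
  have hpos := goldenRatio_pos
  have key : ∀ (a b : ℕ) (x y : ℝ), 0 < x → 0 < y → x ^ a < y ^ b →
      a * Real.log x < b * Real.log y := by
    intro a b x y hx hy h
    simpa [Real.log_pow] using Real.log_lt_log (pow_pos hx a) h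
  constructor
  · refine key 84 121 _ _ two_pos hpos ?_
    rw [← goldenRatio_mul_fib_succ_add_fib]
    norm_num
    linarith
  · refine key 157 109 _ _ hpos two_pos ?_
    rw [← goldenRatio_mul_fib_succ_add_fib]
    norm_num
    linarith

theorem sqrt_five_bounds : 2.2355 < √5 ∧ √5 < 2.2365 :=
  ⟨Real.lt_sqrt_of_sq_lt (by norm_num), (Real.sqrt_lt' (by norm_num)).2 (by norm_num)⟩

/-- At α = 1/2 the condition is (1 − 2π)(1 − π) = π², that is π² − 3π + 1 = 0. -/
theorem balanced_half : Balanced (1 / 2) ((3 - √5) / 2) := by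
  obtain ⟨h1, h2⟩ := sqrt_five_bounds
  have h5 : √5 ^ 2 = 5 := Real.sq_sqrt (by norm_num)
  have q0 : 0 < 1 - 2 * ((3 - √5) / 2) := by linarith
  have q1 : 0 < 1 - (3 - √5) / 2 := by linarith
  have hmul : (1 - 2 * ((3 - √5) / 2)) * (1 - (3 - √5) / 2) = ((3 - √5) / 2) ^ 2 := by
    linear_combination (1 / 4) * h5
  have := congrArg Real.log hmul
  rw [Real.log_mul q0.ne' q1.ne', Real.log_pow] at this
  push_cast at this
  rw [Balanced]
  linear_combination (1 / 4) * this

/-- Here 1 − π = φ⁻¹ and 1 − 2π = φ⁻³, so a single logarithm remains. -/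
theorem blockDiv_half :
    blockDiv (1 / 2) ((3 - √5) / 2) = 5 / 4 * Real.log Real.goldenRatio := by
  have h5 : √5 ^ 2 = 5 := Real.sq_sqrt (by norm_num)
  have h1 : 1 - (3 - √5) / 2 = Real.goldenRatio⁻¹ := by
    rw [Real.inv_goldenRatio, Real.goldenConj]
    ring
  have h2 : 1 - 2 * ((3 - √5) / 2) = Real.goldenRatio⁻¹ ^ 3 := by
    rw [Real.inv_goldenRatio, Real.goldenConj]
    linear_combination (3 / 8 - √5 / 8) * h5
  rw [blockDiv, h1, h2, Real.log_pow, Real.log_inv]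
  push_cast
  ring

theorem mem_Ioo_half : (3 - √5) / 2 ∈ Set.Ioo (0 : ℝ) (1 / 2) := by
  obtain ⟨h1, h2⟩ := sqrt_five_bounds
  constructor <;> linarith

theorem abs_capacity_half_sub_lt : |capacity (1 / 2) - 0.4339| < 0.00005 := by
  obtain ⟨h1, h2⟩ := goldenRatio_log_bounds
  have hlog := Real.log_pos one_lt_two
  rw [capacity_eq_blockDiv (by norm_num) (by norm_num) mem_Ioo_half.1 mem_Ioo_half.2
    balanced_half, blockDiv_half, abs_lt, lt_sub_iff_add_lt, sub_lt_iff_lt_add,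
    lt_div_iff₀ (by positivity), div_lt_iff₀ (by positivity)]
  constructor <;> linarith

theorem capacity_eq_symInput {α : ℝ} (h0 : 0 ≤ α) (h1 : α ≤ 1) {π : ℝ} (hπ0 : 0 < π)
    (hπ1 : π < 1 / 2) (hb : Balanced α π) :
    capacity α = (1 - α) ^ 2 * (h₂ (2 * π) + 2 * π) / 2 + α * (1 - α) * h₂ π := by
  rw [capacity_eq_blockInfo h0 h1 hπ0 hπ1 hb, blockInfo_symInput h0 h1 hπ0.le hπ1.le]
  ring

end EHBEC

end

theorem mainTheorem1 :
    (∀ α : ℝ, 0 ≤ α → α ≤ 1 →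
      IsLUB {R : ℝ | EHBEC.Achievable α R} (EHBEC.capacity α) ∧
      IsGreatest ((fun P => 1 / 2 * EHBEC.blockInfo α P) '' EHBEC.blockInputs)
        (EHBEC.capacity α) ∧
      IsGreatest ((fun P => 1 / 2 * (EHBEC.blockOutEntropy α P - EHBEC.blockCondEntropy α P)) ''
        EHBEC.blockInputs) (EHBEC.capacity α) ∧
      IsGreatest ((fun P => 1 / 2 * EHBEC.blockOutEntropy α P - EHBEC.h₂ α) ''
        EHBEC.blockInputs) (EHBEC.capacity α) ∧
      (∀ π : ℝ, 0 ≤ π → π ≤ 1 / 2 →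
        EHBEC.blockInfo α (EHBEC.symInput π) =
          (1 - α) ^ 2 * (EHBEC.h₂ (2 * π) + 2 * π) + 2 * α * (1 - α) * EHBEC.h₂ π)) ∧
    (∀ α : ℝ, 0 ≤ α → α < 1 →
      (∃! π : ℝ, π ∈ Set.Ioo (0 : ℝ) (1 / 2) ∧ EHBEC.Stationary α π) ∧
      (∀ π : ℝ, π ∈ Set.Ioo (0 : ℝ) (1 / 2) → EHBEC.Stationary α π →
        (∀ P : (Fin 2 → Fin 2) → ℝ, EHBEC.IsOptimalInput α P ↔ P = EHBEC.symInput π) ∧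
        EHBEC.capacity α =
          (1 - α) ^ 2 * (EHBEC.h₂ (2 * π) + 2 * π) / 2 + α * (1 - α) * EHBEC.h₂ π)) ∧
    ((3 - √5) / 2 ∈ Set.Ioo (0 : ℝ) (1 / 2) ∧
      EHBEC.Stationary (1 / 2) ((3 - √5) / 2) ∧
      |(3 - √5) / 2 - 0.382| < 0.0005 ∧
      EHBEC.capacity (1 / 2) =
        1 / 8 * (EHBEC.h₂ (3 - √5) + 2 * EHBEC.h₂ ((3 - √5) / 2) + 3 - √5) ∧
      |EHBEC.capacity (1 / 2) - 0.4339| < 0.00005) := by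
  refine ⟨fun α h0 h1 => ⟨?_, EHBEC.isGreatest_blockInfo h0 h1, ?_, ?_,
      fun π hπ0 hπ1 => EHBEC.blockInfo_symInput h0 h1 hπ0 hπ1⟩,
    fun α h0 h1 => ⟨EHBEC.existsUnique_stationary h1, fun π ⟨hπ0, hπ1⟩ hs => ?_⟩,
    EHBEC.mem_Ioo_half, ?_, ?_, ?_, EHBEC.abs_capacity_half_sub_lt⟩
  · obtain ⟨π, hπ0, hπ1, hb⟩ := EHBEC.exists_balanced h1
    rw [EHBEC.capacity_eq_blockDiv h0 h1 hπ0 hπ1 hb]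
    exact EHBEC.isLUB_achievable h0 h1 hπ0 hπ1 hb
  · have h := EHBEC.isGreatest_blockInfo h0 h1
    rwa [Set.image_congr fun P hP => by rw [EHBEC.blockInfo_eq_sub h0 h1 hP]] at h
  · have h := EHBEC.isGreatest_blockInfo h0 h1
    rwa [Set.image_congr (g := fun P => 1 / 2 * EHBEC.blockOutEntropy α P - EHBEC.h₂ α)
      fun P hP => by
        rw [EHBEC.blockInfo_eq_sub h0 h1 hP, EHBEC.blockCondEntropy_eq α hP]
        ring] at h
  · have hb := (EHBEC.stationary_iff_balanced h1 hπ0 hπ1).1 hs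
    exact ⟨EHBEC.isOptimalInput_iff h0 h1 hπ0 hπ1 hb,
      EHBEC.capacity_eq_symInput h0 h1.le hπ0 hπ1 hb⟩
  · exact (EHBEC.stationary_iff_balanced (by norm_num) EHBEC.mem_Ioo_half.1
      EHBEC.mem_Ioo_half.2).2 EHBEC.balanced_half
  · obtain ⟨h1, h2⟩ := EHBEC.sqrt_five_bounds
    rw [abs_lt]
    constructor <;> linarith
  · rw [EHBEC.capacity_eq_symInput (by norm_num) (by norm_num) EHBEC.mem_Ioo_half.1
      EHBEC.mem_Ioo_half.2 EHBEC.balanced_half, mul_div_cancel₀ _ two_ne_zero]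
    ring
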